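/- Let $\{t\}=t-\lfloor t\rfloor$ and $[N]=\{1,\dots,N\}$. For $x_0\ge 1$ let $\mathcal L$ be the set of functions $\ell:[x_0,\infty)\to[1,\infty)$ of the form $\ell(x)=\exp\big(\int_{x_0}^x\frac{\vartheta(t)}{t}\,dt\big)$ with a real-valued $\vartheta\in C^2([x_0,\infty))$ such that $\vartheta(x)\to0$, $x\vartheta'(x)\to0$ and $x^2\vartheta''(x)\to0$ as $x\to\infty$. Let $\mathcal L_0$ be the set of functions $\ell:[x_0,\infty)\to[1,\infty)$ of the same form for which $\vartheta\in C^2([x_0,\infty))$ is positive and decreasing (not necessarily strictly), $\vartheta(x)\to0$, $x\vartheta'(x)/\vartheta(x)\to0$ and $x^2\vartheta''(x)/\vartheta(x)\to0$ as $x\to\infty$, for every $\varepsilon>0$ there is $C_\varepsilon>0$ with $\vartheta(x)\ge C_\varepsilon x^{-\varepsilon}$ for all $x\ge x_0$, and $\lim_{x\to\infty}\ell(x)=\infty$. For $c>1$ let $\mathcal R_c$ be the set of strictly increasing convex functions $h:[x_0,\infty)\to[1,\infty)$ (for some $x_0\ge1$) of the form $h(x)=x^c\ell(x)$ with $\ell\in\mathcal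 L$; let $\mathcal R_1$ be defined in the same way with $c=1$ and the extra requirement $\ell\in\mathcal L_0$. Let $c_1,c_2\in[1,16/15)$, $h_1\in\mathcal R_{c_1}$ and $h_2\in\mathcal R_{c_2}$, where the starting points $x_0$ of the domains of $h_1$ and $h_2$ may differ. Let $\varphi_1,\varphi_2$ be the inverse functions of $h_1,h_2$. Let $\psi:[1,\infty)\to(0,1/2]$ be a $C^2$ function with $\psi\sim\varphi_2'$, $\psi'\sim\varphi_2''$ and $\psi''\sim\varphi_2'''$ as $x\to\infty$ (where $f\sim g$ means $f/g\to1$). Put $$B_+=\{n\in\mathbb N:\{\varphi_1(n)\}<\psi(n)\},\qquad B_-=\{n\in\mathbb N:\{-\varphi_1(n)\}<\psi(n)\},$$ where $n$ runs over the natural numbers in the domain of $\varphi_1$. Let $B$ be either of the sets $B_+$, $B_-$, and let $A\subseteq B$ have positive relative upper density, that is, $$\limsup_{N\to\infty}\frac{|A\cap[N]|}{|B\cap[N]|}>0.$$ Then $A$ contains infinitely many non-trivial three-term arithmetic progressions, that is, there are infinitely many pairs $(a,d)$ of natural numbers with $d>0$ and $a,\,a+d,\,a+2d\in A$. -/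

import Mathlib

open Filter Set Asymptotics

namespace ThinRoth

/-- `ℓ` has the form `ℓ(x) = exp (∫_{x₀}^x ϑ(t)/t dt)` on `[x₀, ∞)`. -/
def HasExpForm (x₀ : ℝ) (ϑ ℓ : ℝ → ℝ) : Prop :=
  ∀ x, x₀ ≤ x → ℓ x = Real.exp (∫ t in x₀..x, ϑ t / t)

/-- The family `𝓛` of slowly varying functions `ℓ : [x₀, ∞) → [1, ∞)`.
Only the values of `ℓ` and `ϑ` on `[x₀, ∞)` matter. -/
def IsSlowlyVarying (x₀ : ℝ) (ℓ : ℝ → ℝ) : Prop :=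
  (∀ x, x₀ ≤ x → 1 ≤ ℓ x) ∧
  ∃ ϑ : ℝ → ℝ, ContDiffOn ℝ 2 ϑ (Ici x₀) ∧
    Tendsto ϑ atTop (nhds 0) ∧
    Tendsto (fun x => x * deriv ϑ x) atTop (nhds 0) ∧
    Tendsto (fun x => x ^ 2 * iteratedDeriv 2 ϑ x) atTop (nhds 0) ∧
    HasExpForm x₀ ϑ ℓ

/-- The subfamily `𝓛₀` of `𝓛`, used for the exponent `c = 1`. -/
def IsSlowlyVaryingZero (x₀ : ℝ) (ℓ : ℝ → ℝ) : Prop :=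
  (∀ x, x₀ ≤ x → 1 ≤ ℓ x) ∧
  Tendsto ℓ atTop atTop ∧
  ∃ ϑ : ℝ → ℝ, ContDiffOn ℝ 2 ϑ (Ici x₀) ∧
    (∀ x, x₀ ≤ x → 0 < ϑ x) ∧
    AntitoneOn ϑ (Ici x₀) ∧
    Tendsto ϑ atTop (nhds 0) ∧
    Tendsto (fun x => x * deriv ϑ x / ϑ x) atTop (nhds 0) ∧
    Tendsto (fun x => x ^ 2 * iteratedDeriv 2 ϑ x / ϑ x) atTop (nhds 0) ∧
    (∀ ε : ℝ, 0 < ε → ∃ C : ℝ, 0 < C ∧ ∀ x, x₀ ≤ x → C * x ^ (-ε) ≤ ϑ x) ∧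
    HasExpForm x₀ ϑ ℓ

/-- The family `𝓡_c` of functions `h : [x₀, ∞) → [1, ∞)`: strictly increasing, convex, and
of the form `x ^ c * ℓ(x)` with `ℓ ∈ 𝓛`, where moreover `ℓ ∈ 𝓛₀` if `c = 1`. -/
def IsRegularlyVarying (c x₀ : ℝ) (h : ℝ → ℝ) : Prop :=
  1 ≤ x₀ ∧
  (∀ x, x₀ ≤ x → 1 ≤ h x) ∧
  StrictMonoOn h (Ici x₀) ∧
  ConvexOn ℝ (Ici x₀) h ∧
  ∃ ℓ : ℝ → ℝ, IsSlowlyVarying x₀ ℓ ∧ (c = 1 → IsSlowlyVaryingZero x₀ ℓ) ∧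
    ∀ x, x₀ ≤ x → h x = x ^ c * ℓ x

/-- The inverse `φ : [h(x₀), ∞) → [x₀, ∞)` of `h : [x₀, ∞) → [h(x₀), ∞)`
(with an irrelevant value outside of `[h(x₀), ∞)`). -/
noncomputable def inverse (x₀ : ℝ) (h : ℝ → ℝ) : ℝ → ℝ :=
  Function.invFunOn h (Ici x₀)

/-- `ψ : [1, ∞) → (0, 1/2]` is of class `C²` and `ψ ∼ φ'`, `ψ' ∼ φ''`, `ψ'' ∼ φ'''` at infinity. -/
def IsWidthFor (φ ψ : ℝ → ℝ) : Prop :=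
  (∀ x, 1 ≤ x → 0 < ψ x ∧ ψ x ≤ 1 / 2) ∧
  ContDiffOn ℝ 2 ψ (Ici 1) ∧
  IsEquivalent atTop ψ (deriv φ) ∧
  IsEquivalent atTop (deriv ψ) (iteratedDeriv 2 φ) ∧
  IsEquivalent atTop (iteratedDeriv 2 ψ) (iteratedDeriv 3 φ)

/-- `B₊ = {n : {φ(n)} < ψ(n)}`, over the natural numbers `n` in the domain `[h(x₀), ∞)` of the
inverse `φ` of `h`. -/
def BPlus (x₀ : ℝ) (h ψ : ℝ → ℝ) : Set ℕ :=
  {n | h x₀ ≤ n ∧ Int.fract (inverse x₀ h n) < ψ n}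

/-- `B₋ = {n : {-φ(n)} < ψ(n)}`, over the natural numbers `n` in the domain `[h(x₀), ∞)` of the
inverse `φ` of `h`. -/
def BMinus (x₀ : ℝ) (h ψ : ℝ → ℝ) : Set ℕ :=
  {n | h x₀ ≤ n ∧ Int.fract (-inverse x₀ h n) < ψ n}

/-- The relative upper density `limsup |A ∩ [N]| / |B ∩ [N]|`, where `[N] = {1, …, N}`. It is used
for `A ⊆ B`, where all the quotients lie in `[0, 1]`. -/
noncomputable def relUpperDensity (A B : Set ℕ) : ℝ :=
  limsup (fun N : ℕ => ((A ∩ Icc 1 N).ncard : ℝ) / ((B ∩ Icc 1 N).ncard : ℝ)) atTop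

/-- The non-trivial three-term progressions `a, a + d, a + 2d` (`d > 0`) in `A`, as pairs `(a, d)`. -/
def nontrivialThreeAPs (A : Set ℕ) : Set (ℕ × ℕ) :=
  {p | 0 < p.2 ∧ p.1 ∈ A ∧ p.1 + p.2 ∈ A ∧ p.1 + 2 * p.2 ∈ A}

end ThinRoth

/-! Far out, put `s ^ 15` equal to the position. The phase `G = ±φ₁` then has a monotone derivative
whose rate of change lies between `s⁻¹⁶` and `C s⁻¹⁵`, and the width `ψ` is at least `s⁻¹`. No
asymptotic count of `B` and no exponential sum is needed: Roth's theorem is transferred locally.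

On a window of length about `s ^ 12` the slope of `G` is almost constant, so Dirichlet's theorem
gives `q = O(R s)` for which a shift by `q` moves `G` modulo one by at most `1 / (2 R s)`, a small
part of the width. A member of `B` that leaves `B` under this shift is therefore preceded by `R`
members in steps of `q`, except for `O(s ^ 2)` places where the increment is so small that its sign
is not stable (`fract_lt_of_exit`, `IsPhaseOn.card_bad_exits_le`). So `B` is nearly invariant under
the shift by `q`. Averaging over progressions of length `K` and difference `q` bounds a
progression-free `A` by about `2 r(K) / K` times `B`, where `r(K)` is the Roth number
(`IsPhaseOn.window_bound`); Roth's theorem, `r(K) = o(K)`, makes this factor as small as desired.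

The windows `[k ^ 5, (k + 1) ^ 5)` have `s ^ 3 = k`; their errors `O(s ^ 2)`, bounded by `O(k)`, add
up to `O(k ^ 2) = O(s ^ 6)`. A crude lower bound `|B ∩ [N]| ≥ s ^ 7` absorbs them
(`IsPhaseOn.card_ge`): near a point where the slope is rational with denominator about `4 s`, steps
of that length sweep slowly round the circle and must hit the target arc. Hence a set without
progressions beyond some point has relative upper density zero. -/

namespace ThinRoth

/-! ### Roth's theorem in a set that is nearly invariant under a shift -/

/-- Double count the sums `a + j q` with `a ∈ A` and `j < K`. A walk that leaves `S` does so through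
an exit, so the sums fill few places. The indices `j` that reach a fixed place form a
progression-free set, because `a = m - j q` is affine in `j`. -/
theorem card_mul_le_rothNumberNat_mul {A S : Finset ℕ} (hAS : A ⊆ S)
    (hA : ThreeAPFree (A : Set ℕ)) {q : ℕ} (hq : 0 < q) (K : ℕ) :
    K * A.card ≤ rothNumberNat K * (S.card + K * (S.filter (fun e => e + q ∉ S)).card) := by
  classical
  set E := S.filter (fun e => e + q ∉ S) with hE
  set D := S ∪ (E ×ˢ Finset.range K).image (fun p => p.1 + p.2 * q) with hD
  have hDcard : D.card ≤ S.card + K * E.card := by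
    refine (Finset.card_union_le _ _).trans (Nat.add_le_add_left ?_ _)
    refine Finset.card_image_le.trans ?_
    rw [Finset.card_product, Finset.card_range, mul_comm]
  have key : ∀ a ∈ A, ∀ j, a + j * q ∈ S ∨ ∃ e ∈ E, ∃ i ≤ j, a + j * q = e + i * q := by
    intro a ha j
    induction j with
    | zero => left; simpa using hAS ha
    | succ j ih =>
      by_cases hS : a + (j + 1) * q ∈ S
      · exact Or.inl hS
      right
      rcases ih with h | ⟨e, he, i, hi, h⟩
      · refine ⟨a + j * q, ?_, 1, by omega, by ring⟩
        rw [hE, Finset.mem_filter]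
        refine ⟨h, ?_⟩
        rwa [add_assoc, ← Nat.succ_mul]
      · exact ⟨e, he, i + 1, by omega, by linear_combination h⟩
  have hcount : (A ×ˢ Finset.range K).card ≤ rothNumberNat K * D.card := by
    refine Finset.card_le_mul_card_image_of_maps_to (f := fun p => p.1 + p.2 * q) ?_ _ ?_
    · rintro ⟨a, j⟩ hp
      simp only [Finset.mem_product, Finset.mem_range] at hp
      rw [hD, Finset.mem_union]
      rcases key a hp.1 j with h | ⟨e, he, i, hi, h⟩
      · exact Or.inl h
      · right
        rw [Finset.mem_image]
        refine ⟨(e, i), ?_, h.symm⟩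
        simp only [Finset.mem_product, Finset.mem_range]
        exact ⟨he, by omega⟩
    · intro m _
      set F := (A ×ˢ Finset.range K).filter (fun p => p.1 + p.2 * q = m) with hF
      have hinj : Set.InjOn Prod.snd (F : Set (ℕ × ℕ)) := by
        rintro ⟨a, j⟩ h1 ⟨a', j'⟩ h2 h
        simp only [hF, Finset.coe_filter, Finset.mem_product, mem_ofPred_eq] at h1 h2 h
        subst h
        have := h1.2.trans h2.2.symm
        simp only [Prod.mk.injEq, and_true]
        omega
      rw [← Finset.card_image_of_injOn hinj]
      refine ThreeAPFree.le_rothNumberNat _ ?_ ?_ rfl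
      · rintro j1 h1 j2 h2 j3 h3 h
        simp only [hF, Finset.coe_image, Finset.coe_filter, Finset.mem_product, mem_image,
          mem_ofPred_eq, Prod.exists, exists_eq_right] at h1 h2 h3
        obtain ⟨a1, ⟨h1, -⟩, e1⟩ := h1
        obtain ⟨a2, ⟨h2, -⟩, e2⟩ := h2
        obtain ⟨a3, ⟨h3, -⟩, e3⟩ := h3
        have hq' : j1 * q + j3 * q = j2 * q + j2 * q := by rw [← add_mul, h, add_mul]
        have : a1 = a2 := hA (by simpa using h1) (by simpa using h2) (by simpa using h3) (by omega)
        subst this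
        exact Nat.eq_of_mul_eq_mul_right hq (by omega)
      · intro x hx
        simp only [hF, Finset.mem_image, Finset.mem_filter, Finset.mem_product, Finset.mem_range,
          Prod.exists, exists_eq_right] at hx
        obtain ⟨a, ⟨_, h⟩, _⟩ := hx
        exact h
  rw [Finset.card_product, Finset.card_range, mul_comm] at hcount
  exact hcount.trans (Nat.mul_le_mul_left _ hDcard)

/-- The runs of length `R` that end at different exits are disjoint subsets of `S`. -/
theorem mul_card_le_card_of_long_runs {S E : Finset ℕ} {q R : ℕ}
    (hE : ∀ e ∈ E, e + q ∉ S) (hrun : ∀ e ∈ E, ∀ j < R, ∃ m ∈ S, m + j * q = e) :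
    R * E.card ≤ S.card := by
  classical
  have : (E ×ˢ Finset.range R).card ≤ S.card := by
    refine Finset.card_le_card_of_injOn (fun p => p.1 - p.2 * q) ?_ ?_
    · rintro ⟨e, j⟩ hp
      simp only [Finset.coe_product, mem_prod, Finset.mem_coe, Finset.mem_range] at hp
      obtain ⟨m, hm, h⟩ := hrun e hp.1 j hp.2
      have : e - j * q = m := by omega
      simpa [this] using hm
    -- If `e - j q = e' - j' q` with `j < j'`, then `e + q = e' - (j' - j - 1) q` is in the run of
    -- `e'`, hence in `S`, although `e` is an exit.
    · have aux : ∀ e ∈ E, ∀ e' ∈ E, ∀ j j', j < j' → j' < R → ∀ m, m + j * q = e →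
          m + j' * q = e' → False := by
        intro e he e' he' j j' hj hj' m h h'
        obtain ⟨i, rfl⟩ : ∃ i, j' = j + 1 + i := ⟨j' - (j + 1), by omega⟩
        obtain ⟨m', hm', h''⟩ := hrun e' he' i (by omega)
        apply hE e he
        convert hm' using 1
        have : (j + 1 + i) * q = j * q + q + i * q := by ring
        omega
      rintro ⟨e, j⟩ hp ⟨e', j'⟩ hp' h
      simp only [Finset.coe_product, mem_prod, Finset.mem_coe, Finset.mem_range] at hp hp' h
      obtain ⟨m, hm, h1⟩ := hrun e hp.1 j hp.2
      obtain ⟨m', hm', h2⟩ := hrun e' hp'.1 j' hp'.2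
      have hmm : m' = m := by omega
      subst hmm
      rcases lt_trichotomy j j' with hlt | rfl | hlt
      · exact (aux e hp.1 e' hp'.1 j j' hlt hp'.2 _ h1 h2).elim
      · simp only [Prod.mk.injEq, and_true]; omega
      · exact (aux e' hp'.1 e hp.1 j' j hlt hp.2 _ h2 h1).elim
  rwa [Finset.card_product, Finset.card_range, mul_comm] at this

theorem card_le_of_pairwise_dist {Z : Finset ℕ} {D : ℝ} (hD : 0 ≤ D)
    (h : ∀ m ∈ Z, ∀ n ∈ Z, m ≤ n → (n : ℝ) - m ≤ D) : (Z.card : ℝ) ≤ D + 1 := by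
  rcases Z.eq_empty_or_nonempty with rfl | hne
  · simp; linarith
  have hsub : Z ⊆ Finset.Icc (Z.min' hne) (Z.min' hne + ⌊D⌋₊) := by
    intro n hn
    rw [Finset.mem_Icc]
    refine ⟨Finset.min'_le _ _ hn, ?_⟩
    have h1 := h _ (Finset.min'_mem Z hne) n hn (Finset.min'_le _ _ hn)
    rw [← Nat.cast_sub (Finset.min'_le _ _ hn)] at h1
    have := Nat.le_floor h1
    omega
  have := Finset.card_le_card hsub
  rw [Nat.card_Icc] at this
  have h2 : Z.card ≤ ⌊D⌋₊ + 1 := by omega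
  calc (Z.card : ℝ) ≤ (⌊D⌋₊ : ℝ) + 1 := by exact_mod_cast h2
    _ ≤ D + 1 := by gcongr; exact Nat.floor_le hD

/-! ### Phases with slowly varying slope and their increments -/

/-- On `I` the derivative `g` of `G` is monotone with rate between `s⁻¹⁶` and `C s⁻¹⁵` (increasing if
`κ = 1` and decreasing if `κ = -1`), and the width `ψ ≥ s⁻¹` varies at rate at most `C s⁻¹⁵`. -/
structure IsPhaseOn (κ C s : ℝ) (G g ψ : ℝ → ℝ) (I : Set ℝ) : Prop where
  deriv : ∀ t ∈ I, HasDerivAt G (g t) t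
  lower : ∀ t ∈ I, ∀ t' ∈ I, t ≤ t' → (t' - t) / s ^ 16 ≤ κ * (g t' - g t)
  upper : ∀ t ∈ I, ∀ t' ∈ I, t ≤ t' → κ * (g t' - g t) ≤ C * (t' - t) / s ^ 15
  width : ∀ t ∈ I, 1 / s ≤ ψ t
  lip : ∀ t ∈ I, ∀ t' ∈ I, |ψ t - ψ t'| ≤ C * |t - t'| / s ^ 15

theorem abs_sub_eq_of_abs_eq_one {κ a b : ℝ} (hκ : |κ| = 1) : |κ * (a - b)| = |a - b| := by
  rw [abs_mul, hκ, one_mul]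

namespace IsPhaseOn

variable {κ C s : ℝ} {G g ψ : ℝ → ℝ} {I J : Set ℝ}

theorem mono (h : IsPhaseOn κ C s G g ψ I) (hJ : J ⊆ I) : IsPhaseOn κ C s G g ψ J :=
  ⟨fun t ht => h.deriv t (hJ ht), fun t ht t' ht' => h.lower t (hJ ht) t' (hJ ht'),
    fun t ht t' ht' => h.upper t (hJ ht) t' (hJ ht'), fun t ht => h.width t (hJ ht),
    fun t ht t' ht' => h.lip t (hJ ht) t' (hJ ht')⟩

theorem abs_sub_le (h : IsPhaseOn κ C s G g ψ I) (hκ : |κ| = 1) (hs : 0 < s) {t t' : ℝ}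
    (ht : t ∈ I) (ht' : t' ∈ I) : |g t - g t'| ≤ C * |t - t'| / s ^ 15 := by
  wlog hle : t ≤ t' generalizing t t'
  · rw [abs_sub_comm (g t), abs_sub_comm t]
    exact this ht' ht (le_of_not_ge hle)
  rw [abs_sub_comm (g t), abs_sub_comm t, ← abs_sub_eq_of_abs_eq_one hκ,
    abs_of_nonneg (sub_nonneg.2 hle), abs_of_nonneg]
  · exact h.upper t ht t' ht' hle
  · exact le_trans (by have := sub_nonneg.2 hle; positivity) (h.lower t ht t' ht' hle)

theorem le_abs_sub (h : IsPhaseOn κ C s G g ψ I) (hκ : |κ| = 1) {t t' : ℝ}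
    (ht : t ∈ I) (ht' : t' ∈ I) (hle : t ≤ t') : (t' - t) / s ^ 16 ≤ |g t' - g t| := by
  rw [← abs_sub_eq_of_abs_eq_one hκ]
  exact (h.lower t ht t' ht' hle).trans (le_abs_self _)

theorem exists_sub_eq {u w : ℝ} (h : IsPhaseOn κ C s G g ψ (Icc u w)) {x y : ℝ} (hxy : x < y)
    (hx : u ≤ x) (hy : y ≤ w) : ∃ t ∈ Icc x y, G y - G x = (y - x) * g t := by
  have hd : ∀ t ∈ Icc x y, HasDerivAt G (g t) t := fun t ht =>
    h.deriv t ⟨hx.trans ht.1, ht.2.trans hy⟩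
  obtain ⟨t, ht, h1⟩ := exists_hasDerivAt_eq_slope G g hxy
    (fun t ht => (hd t ht).continuousAt.continuousWithinAt)
    (fun t ht => hd t (Ioo_subset_Icc_self ht))
  refine ⟨t, Ioo_subset_Icc_self ht, ?_⟩
  rw [h1, mul_div_cancel₀]
  linarith

theorem abs_increment_sub_le {u w : ℝ} (h : IsPhaseOn κ C s G g ψ (Icc u w)) (hκ : |κ| = 1)
    (hs : 0 < s) (hC : 0 ≤ C) {x y q : ℝ} (hq : 0 < q) (hx : u ≤ x) (hy : u ≤ y) (hxw : x + q ≤ w)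
    (hyw : y + q ≤ w) :
    |(G (x + q) - G x) - (G (y + q) - G y)| ≤ C * q * (|x - y| + q) / s ^ 15 := by
  obtain ⟨t, ht, h1⟩ := h.exists_sub_eq (lt_add_of_pos_right x hq) hx hxw
  obtain ⟨t', ht', h2⟩ := h.exists_sub_eq (lt_add_of_pos_right y hq) hy hyw
  rw [h1, h2, add_sub_cancel_left, add_sub_cancel_left, ← mul_sub, abs_mul, abs_of_pos hq]
  have h3 := h.abs_sub_le hκ hs (t := t) (t' := t') ⟨hx.trans ht.1, ht.2.trans hxw⟩
    ⟨hy.trans ht'.1, ht'.2.trans hyw⟩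
  have h4 : |t - t'| ≤ |x - y| + q := by
    have := le_abs_self (x - y)
    have := neg_abs_le (x - y)
    obtain ⟨_, _⟩ := ht
    obtain ⟨_, _⟩ := ht'
    rw [abs_le]
    constructor <;> linarith
  calc q * |g t - g t'| ≤ q * (C * (|x - y| + q) / s ^ 15) := by
        refine mul_le_mul_of_nonneg_left (h3.trans ?_) hq.le
        gcongr
    _ = _ := by ring

/-- The map `t ↦ G (t + q) - G t` has derivative `g (t + q) - g t`, of size at least `q / s ^ 16`.
This strict drift confines the places with almost vanishing increment to a short interval. -/
theorem le_abs_increment_sub {u w : ℝ} (h : IsPhaseOn κ C s G g ψ (Icc u w)) (hκ : |κ| = 1)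
    {x y q : ℝ} (hq : 0 < q) (hx : u ≤ x) (hxy : x ≤ y) (hyw : y + q ≤ w) :
    (y - x) * q / s ^ 16 ≤ |(G (y + q) - G y) - (G (x + q) - G x)| := by
  rcases hxy.eq_or_lt with rfl | hlt
  · simp
  have hd : ∀ t ∈ Icc x y, HasDerivAt (fun t => G (t + q) - G t) (g (t + q) - g t) t := by
    intro t ht
    have h1 := h.deriv (t + q) ⟨by linarith [ht.1], by linarith [ht.2]⟩
    have h2 := h.deriv t ⟨by linarith [ht.1], by linarith [ht.2]⟩
    exact (h1.comp_add_const t q).sub h2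
  obtain ⟨t, ht, h1⟩ := exists_hasDerivAt_eq_slope _ _ hlt
    (fun t ht => (hd t ht).continuousAt.continuousWithinAt)
    (fun t ht => hd t (Ioo_subset_Icc_self ht))
  have h2 := h.le_abs_sub hκ (t := t) (t' := t + q) ⟨by linarith [ht.1], by linarith [ht.2]⟩
    ⟨by linarith [ht.1], by linarith [ht.2]⟩ (by linarith)
  have h3 : (G (y + q) - G y) - (G (x + q) - G x) = (y - x) * (g (t + q) - g t) := by
    rw [h1, mul_div_cancel₀]
    linarith
  rw [h3, abs_mul, abs_of_pos (sub_pos.2 hlt), mul_div_assoc]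
  refine mul_le_mul_of_nonneg_left ?_ (sub_pos.2 hlt).le
  simpa using h2

end IsPhaseOn

/-! ### Exits from the Bohr-type set -/

/-- A member `e` of the Bohr-type set `{G} < ψ` that leaves it after one step `q`, and at which the
increment of `G` modulo one is small but not too small, is preceded by a long run of members. -/
theorem fract_lt_of_exit {G ψ : ℝ → ℝ} {e q β τ s : ℝ} {a : ℤ} {R : ℕ}
    (hτ : 0 ≤ τ)
    (hβ : (R : ℝ) * β < 1 / s)
    (hwidth : ∀ j ≤ R, 1 / s ≤ ψ (e + q - j * q))
    (hlip : ∀ j ≤ R, |ψ (e + q - j * q) - ψ e| ≤ τ)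
    (hzone : 2 * τ < |G (e + q) - G e - a|)
    (hinc : ∀ j < R, |G (e + q - j * q) - G (e - j * q) - a| ≤ β)
    (hvar : ∀ j < R, |(G (e + q - j * q) - G (e - j * q)) - (G (e + q) - G e)| ≤ τ)
    (hmem : Int.fract (G e) < ψ e) (hexit : ¬ Int.fract (G (e + q)) < ψ (e + q)) :
    ∀ j < R, Int.fract (G (e - j * q)) < ψ (e - j * q) := by
  intro j hj
  have hR : 0 < R := by omega
  set m := ⌊G e⌋ with hm
  have hfr : Int.fract (G e) = G e - m := rfl
  have hx0 : 0 ≤ G e - m := hfr ▸ Int.fract_nonneg _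
  rw [hfr] at hmem
  have hβ0 : 0 ≤ β := (abs_nonneg _).trans (hinc 0 hR)
  have hjβ : ((j : ℝ) + 1) * β ≤ R * β := by
    refine mul_le_mul_of_nonneg_right ?_ hβ0
    exact_mod_cast hj
  have h0 := hinc 0 hR
  simp only [Nat.cast_zero, zero_mul, sub_zero] at h0
  obtain ⟨h0l, h0r⟩ := abs_le.1 h0
  have hstep : ∀ i : ℕ, e + q - (i + 1 : ℕ) * q = e - i * q := by intro i; push_cast; ring
  have hψj : |ψ (e - j * q) - ψ e| ≤ τ := by
    have := hlip (j + 1) hj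
    rwa [hstep] at this
  have hwj : 1 / s ≤ ψ (e - j * q) := by
    have := hwidth (j + 1) hj
    rwa [hstep] at this
  have hψ0 : |ψ (e + q) - ψ e| ≤ τ := by simpa using hlip 0 (Nat.zero_le _)
  have hw0 : 1 / s ≤ ψ (e + q) := by simpa using hwidth 0 (Nat.zero_le _)
  obtain ⟨hψjl, hψjr⟩ := abs_le.1 hψj
  obtain ⟨hψ0l, hψ0r⟩ := abs_le.1 hψ0
  -- It suffices to control the value of `G` shifted by an integer.
  have reduce : ∀ (t : ℝ) (b : ℤ), 0 ≤ G t - b → G t - b < ψ t → Int.fract (G t) < ψ t := by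
    intro t b hb hlt
    rw [← Int.fract_sub_intCast (G t) b]
    refine lt_of_le_of_lt ?_ hlt
    rw [Int.fract]
    have : (0 : ℝ) ≤ ⌊G t - b⌋ := by exact_mod_cast Int.floor_nonneg.2 hb
    linarith
  -- After removal of the integers `a` and `m`, the point leaves `[0, ψ)` at the lower or at the
  -- upper end. Since the increment exceeds `2 τ` in size, its sign agrees with the side of the
  -- exit, and the earlier increments keep this sign with size between `τ` and `β`.
  have hout : G (e + q) - a - m < 0 ∨ ψ (e + q) ≤ G (e + q) - a - m := by
    by_contra! hcon
    refine hexit (reduce _ (a + m) ?_ ?_) <;> push_cast <;> linarith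
  refine reduce _ (m - j * a) ?_ ?_ <;> push_cast
  all_goals
    rcases hout with hout | hout
    -- Lower end: backwards the value rises, but only to `(j + 1) β ≤ R β < 1 / s`, which is within
    -- the width.
    · have hθ0 : G (e + q) - G e - a < -(2 * τ) := by
        rcases lt_abs.1 hzone with h | h <;> linarith
      have hind : ∀ i ≤ j, G e + i * τ ≤ G (e - i * q) + i * a ∧
          G (e - i * q) + i * a ≤ G e + i * β := by
        intro i
        induction i with
        | zero => simp
        | succ i ih =>
          intro hi
          obtain ⟨l1, l2⟩ := ih (by omega)
          have h1 := hinc (i + 1) (by omega)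
          have h2 := hvar (i + 1) (by omega)
          rw [hstep, abs_le] at h1 h2
          obtain ⟨_, _⟩ := h1
          obtain ⟨_, _⟩ := h2
          push_cast at *
          constructor <;> linarith
      obtain ⟨l1, l2⟩ := hind j le_rfl
      have : 0 ≤ j * τ := by positivity
      linarith
    -- Upper end: backwards the value falls, but stays at least `1 / s - R β > 0`.
    · have hθ0 : 2 * τ < G (e + q) - G e - a := by
        rcases lt_abs.1 hzone with h | h <;> linarith
      have hind : ∀ i ≤ j, G e - i * β ≤ G (e - i * q) + i * a ∧
          G (e - i * q) + i * a ≤ G e - i * τ := by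
        intro i
        induction i with
        | zero => simp
        | succ i ih =>
          intro hi
          obtain ⟨l1, l2⟩ := ih (by omega)
          have h1 := hinc (i + 1) (by omega)
          have h2 := hvar (i + 1) (by omega)
          rw [hstep, abs_le] at h1 h2
          obtain ⟨_, _⟩ := h1
          obtain ⟨_, _⟩ := h2
          push_cast at *
          constructor <;> linarith
      obtain ⟨l1, l2⟩ := hind j le_rfl
      rcases Nat.eq_zero_or_pos j with rfl | hjpos
      · simp only [Nat.cast_zero, zero_mul, sub_zero, add_zero] at *
        linarith
      -- A single backward step already outweighs the variation `τ` of the width.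
      have : τ ≤ j * τ := le_mul_of_one_le_left hτ (by exact_mod_cast hjpos)
      linarith

/-! ### The estimate on one window -/

theorem exists_common_difference {α s : ℝ} {R : ℕ} (hs : 1 ≤ s) (hR : 1 ≤ R) :
    ∃ q : ℕ, 0 < q ∧ (q : ℝ) ≤ 5 * R * s ∧ ∃ a : ℤ, |q * α - a| ≤ 1 / (4 * R * s) := by
  have hR' : (1 : ℝ) ≤ R := by exact_mod_cast hR
  have hRs : 1 ≤ R * s := by nlinarith
  have hQ : 0 < ⌈4 * R * s⌉₊ := Nat.ceil_pos.2 (by nlinarith)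
  obtain ⟨a, k, hk0, hkQ, hk⟩ := Real.exists_int_int_abs_mul_sub_le α hQ
  lift k to ℕ using hk0.le
  refine ⟨k, by exact_mod_cast hk0, ?_, a, ?_⟩
  · have h1 : (k : ℝ) ≤ ⌈4 * R * s⌉₊ := by exact_mod_cast hkQ
    have h2 := (Nat.ceil_lt_add_one (a := 4 * R * s) (by nlinarith)).le
    linarith
  · rw [Int.cast_natCast] at hk
    refine hk.trans (one_div_le_one_div_of_le (by nlinarith) ?_)
    have := Nat.le_ceil (4 * R * s)
    linarith

/-- Bad exits lie near the ends of the window, or where the increment is within `2 τ` of `a`. Two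
places of the latter kind have increments within `4 τ`, so the drift of the increment puts them at
distance at most `4 τ s ^ 16 / q`. -/
theorem IsPhaseOn.card_bad_exits_le {κ C s : ℝ} {G g ψ : ℝ → ℝ} {u w q R : ℕ}
    (h : IsPhaseOn κ C s G g ψ (Icc u w)) (hκ : |κ| = 1) (hC : 1 ≤ C) (hs : 1 ≤ s) (hR : 1 ≤ R)
    (hq : 0 < q) (hqs : (q : ℝ) ≤ 5 * R * s) (a : ℤ) {E : Finset ℕ}
    (hE : ∀ e ∈ E, u ≤ e ∧ e < w ∧ (u + R * q ≤ e → e + q < w →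
      |G (e + q) - G e - a| ≤ 2 * (C * (R + 1) * q ^ 2 / s ^ 15))) :
    (E.card : ℝ) ≤ 26 * C * R * (R + 1) * s ^ 2 := by
  classical
  set τ := C * (R + 1) * q ^ 2 / s ^ 15 with hτ
  set Z := E.filter (fun e => u + R * q ≤ e ∧ e + q < w) with hZ
  have hs0 : 0 < s := by linarith
  have hR' : (1 : ℝ) ≤ R := by exact_mod_cast hR
  have hq' : (0 : ℝ) < q := by exact_mod_cast hq
  have hτ0 : 0 ≤ τ := by positivity
  have hsub : E ⊆ Finset.Ico u (u + R * q) ∪ Finset.Ico (w - q) w ∪ Z := by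
    intro e he
    obtain ⟨h1, h2, -⟩ := hE e he
    simp only [Finset.mem_union, Finset.mem_Ico, hZ, Finset.mem_filter]
    by_cases h3 : u + R * q ≤ e
    · by_cases h4 : e + q < w
      · exact Or.inr ⟨he, h3, h4⟩
      · exact Or.inl (Or.inr ⟨by omega, h2⟩)
    · exact Or.inl (Or.inl ⟨h1, by omega⟩)
  have hcard : E.card ≤ R * q + q + Z.card := by
    refine (Finset.card_le_card hsub).trans ((Finset.card_union_le _ _).trans ?_)
    refine Nat.add_le_add_right ((Finset.card_union_le _ _).trans ?_) _
    rw [Nat.card_Ico, Nat.card_Ico]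
    omega
  have hZcard : (Z.card : ℝ) ≤ 4 * C * (R + 1) * q * s + 1 := by
    refine card_le_of_pairwise_dist (by positivity) ?_
    intro m hm n hn hmn
    simp only [hZ, Finset.mem_filter] at hm hn
    have h1 := (hE m hm.1).2.2 hm.2.1 hm.2.2
    have h2 := (hE n hn.1).2.2 hn.2.1 hn.2.2
    have h3 := h.le_abs_increment_sub hκ (x := m) (y := n) hq'
      (by exact_mod_cast (hE m hm.1).1) (by exact_mod_cast hmn) (by exact_mod_cast hn.2.2.le)
    have h4 : |(G (n + q) - G n) - (G (m + q) - G m)| ≤ 4 * τ := by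
      rw [abs_le] at h1 h2 ⊢
      constructor <;> linarith [h1.1, h1.2, h2.1, h2.2]
    have h5 := h3.trans h4
    rw [div_le_iff₀ (by positivity), hτ] at h5
    have h6 : 4 * (C * (R + 1) * q ^ 2 / s ^ 15) * s ^ 16 = (4 * C * (R + 1) * q * s) * q := by
      field_simp
    rw [h6] at h5
    exact le_of_mul_le_mul_right h5 hq'
  have hcard' : (E.card : ℝ) ≤ R * q + q + Z.card := by exact_mod_cast hcard
  -- With `X = C R (R + 1) s ^ 2`, the ends cost `5 X`, the middle `20 X`, and the final `1` at most
  -- `X`: this is the constant `26`.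
  have e1 : ((R : ℝ) + 1) * q ≤ 5 * (C * R * (R + 1) * s ^ 2) := by
    calc ((R : ℝ) + 1) * q ≤ (R + 1) * (5 * R * s) := by gcongr
      _ = 1 * (5 * R * (R + 1)) * (s * 1) := by ring
      _ ≤ C * (5 * R * (R + 1)) * (s * s) := by gcongr
      _ = _ := by ring
  have e2 : 4 * C * (R + 1) * q * s ≤ 20 * (C * R * (R + 1) * s ^ 2) := by
    calc 4 * C * (R + 1) * q * s ≤ 4 * C * (R + 1) * (5 * R * s) * s := by gcongr
      _ = _ := by ring
  have e3 : 1 ≤ C * R * (R + 1) * s ^ 2 := by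
    have := one_le_pow₀ hs (n := 2)
    have h2 : (1 : ℝ) ≤ C * R := by nlinarith
    have h3 : (1 : ℝ) ≤ C * R * (R + 1) := by nlinarith
    nlinarith
  linarith

theorem IsPhaseOn.window_bound {κ C s : ℝ} {G g ψ : ℝ → ℝ} {u w R : ℕ}
    (h : IsPhaseOn κ C s G g ψ (Icc u w)) (hκ : |κ| = 1) (hC : 1 ≤ C) (hR : 1 ≤ R)
    (hs : 640 * C * R ^ 2 ≤ s) (huw : u ≤ w) (hlen : (w : ℝ) - u ≤ 32 * s ^ 12)
    {A S : Finset ℕ} (hS : ∀ n, n ∈ S ↔ u ≤ n ∧ n < w ∧ Int.fract (G n) < ψ n) (hAS : A ⊆ S)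
    (hA : ThreeAPFree (A : Set ℕ)) (K : ℕ) :
    (K * R * A.card : ℝ) ≤ rothNumberNat K * (R + K) * S.card +
      rothNumberNat K * K * R * (26 * C * R * (R + 1) * s ^ 2) := by
  classical
  have hR' : (1 : ℝ) ≤ R := by exact_mod_cast hR
  have hs1 : 1 ≤ s := by nlinarith
  have hs0 : 0 < s := by linarith
  obtain ⟨q, hq, hqs, a, ha⟩ := exists_common_difference (α := g u) hs1 hR
  have hq' : (0 : ℝ) < q := by exact_mod_cast hq
  set τ := C * (R + 1) * q ^ 2 / s ^ 15 with hτ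
  have hτ0 : 0 ≤ τ := by positivity
  have huw' : (u : ℝ) ≤ w := by exact_mod_cast huw
  -- Half of the bound is the Dirichlet error at `u`, half the variation of `q g` over the window;
  -- the latter is where `640 C R ^ 2 ≤ s` is used.
  have hslope : ∀ t ∈ Icc (u : ℝ) w, |q * g t - a| ≤ 1 / (2 * R * s) := by
    intro t ht
    have h1 := h.abs_sub_le hκ hs0 ht ⟨le_rfl, huw'⟩
    have h2 : |t - u| ≤ 32 * s ^ 12 := by
      rw [abs_of_nonneg (by linarith [ht.1])]
      linarith [ht.2]
    have h3 : q * |g t - g u| ≤ 1 / (4 * R * s) := by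
      calc q * |g t - g u| ≤ (5 * R * s) * (C * (32 * s ^ 12) / s ^ 15) := by
            refine mul_le_mul hqs (h1.trans ?_) (abs_nonneg _) (by positivity)
            gcongr
        _ = 160 * C * R / s ^ 2 := by field_simp; ring
        _ ≤ 1 / (4 * R * s) := by
            rw [div_le_div_iff₀ (by positivity) (by positivity)]
            nlinarith
    have h4 : q * g t - a = (q * g u - a) + q * (g t - g u) := by ring
    calc |q * g t - a| ≤ |q * g u - a| + |q * (g t - g u)| := h4 ▸ abs_add_le _ _
      _ = |q * g u - a| + q * |g t - g u| := by rw [abs_mul, abs_of_pos hq']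
      _ ≤ 1 / (4 * R * s) + 1 / (4 * R * s) := add_le_add ha h3
      _ = _ := by field_simp; ring
  set E := S.filter (fun e => e + q ∉ S) with hE
  set good := E.filter (fun e => ∀ j < R, ∃ m ∈ S, m + j * q = e) with hgood
  set bad := E.filter (fun e => ¬ ∀ j < R, ∃ m ∈ S, m + j * q = e) with hbad
  have hEcard : good.card + bad.card = E.card := Finset.card_filter_add_card_filter_not _
  have hgoodcard : R * good.card ≤ S.card := by
    refine mul_card_le_card_of_long_runs (q := q) ?_ ?_
    · intro e he
      exact (Finset.mem_filter.1 (Finset.mem_filter.1 he).1).2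
    · intro e he
      exact (Finset.mem_filter.1 he).2
  have hbadcard : (bad.card : ℝ) ≤ 26 * C * R * (R + 1) * s ^ 2 := by
    refine h.card_bad_exits_le hκ hC hs1 hR hq hqs a ?_
    intro e he
    obtain ⟨heE, hnot⟩ := Finset.mem_filter.1 he
    obtain ⟨heS, hexit⟩ := Finset.mem_filter.1 heE
    obtain ⟨hue, hew, hfr⟩ := (hS e).1 heS
    refine ⟨hue, hew, fun h1 h2 => ?_⟩
    by_contra! hzone
    apply hnot
    have h1' : (u : ℝ) + R * q ≤ e := by exact_mod_cast h1
    have h2' : (e : ℝ) + q ≤ w := by exact_mod_cast h2.le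
    have hrange : ∀ j : ℕ, j ≤ R → (u : ℝ) ≤ e - j * q ∧ (j : ℝ) * q ≤ R * q := by
      intro j hj
      have : (j : ℝ) * q ≤ R * q := by gcongr
      exact ⟨by linarith, this⟩
    have hjq : ∀ j : ℕ, (0 : ℝ) ≤ j * q := fun j => by positivity
    have key := fract_lt_of_exit (G := G) (ψ := ψ) (e := e) (q := q) (β := 1 / (2 * R * s))
      (τ := τ) (s := s) (a := a) (R := R) hτ0 ?_ ?_ ?_ hzone ?_ ?_ hfr ?_
    · intro j hj
      have hje : j * q ≤ e := by
        have : j * q ≤ R * q := by gcongr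
        omega
      refine ⟨e - j * q, ?_, by omega⟩
      rw [hS]
      have h3 : ((e - j * q : ℕ) : ℝ) = e - j * q := by push_cast [Nat.cast_sub hje]; ring
      refine ⟨?_, by omega, h3 ▸ key j hj⟩
      have : j * q ≤ R * q := by gcongr
      omega
    · rw [mul_one_div, div_lt_div_iff₀ (by positivity) hs0]
      nlinarith [mul_pos (by linarith : (0 : ℝ) < R) hs0]
    · intro j hj
      have := hrange j hj
      exact h.width _ ⟨by linarith, by linarith [hjq j]⟩
    · intro j hj
      have hr := hrange j hj
      refine (h.lip _ ⟨by linarith, by linarith [hjq j]⟩ _ ⟨by linarith [hjq R], by linarith⟩).trans ?_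
      have h3 : |(e : ℝ) + q - j * q - e| ≤ (R + 1) * q := by
        rw [abs_le]; constructor <;> linarith [hjq j, hjq R]
      have h4 : (q : ℝ) ≤ q ^ 2 := by
        have : (1 : ℝ) ≤ q := by exact_mod_cast hq
        nlinarith
      rw [hτ, mul_assoc C]
      gcongr
      exact h3.trans (by gcongr)
    · intro j hj
      have hr := hrange j hj.le
      obtain ⟨t, ht, h3⟩ := h.exists_sub_eq (x := e - j * q) (y := e + q - j * q)
        (by linarith) hr.1 (by linarith [hjq j])
      rw [h3]
      convert hslope t ⟨hr.1.trans ht.1, ht.2.trans (by linarith [hjq j])⟩ using 2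
      ring
    · intro j hj
      have hr := hrange j hj.le
      have h3 := h.abs_increment_sub_le hκ hs0 (by linarith) (x := e - j * q) (y := e) hq' hr.1
        (by linarith [hjq R]) (by linarith [hjq j]) h2'
      rw [show (e : ℝ) - j * q + q = e + q - j * q by ring] at h3
      refine h3.trans ?_
      have h4 : |(e : ℝ) - j * q - e| ≤ R * q := by
        rw [abs_le]; constructor <;> linarith [hjq j, hjq R]
      calc C * q * (|(e : ℝ) - j * q - e| + q) / s ^ 15 ≤ C * q * (R * q + q) / s ^ 15 := by gcongr
        _ = τ := by rw [hτ]; ring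
    · intro hcon
      apply hexit
      rw [hS]
      exact ⟨by omega, h2, by push_cast; exact hcon⟩
  have hmain := card_mul_le_rothNumberNat_mul hAS hA hq K
  have hmain' : (K * A.card : ℝ) ≤ rothNumberNat K * (S.card + K * E.card) := by
    exact_mod_cast hmain
  have hEcard' : (good.card + bad.card : ℝ) = E.card := by exact_mod_cast hEcard
  have hgoodcard' : (R * good.card : ℝ) ≤ S.card := by exact_mod_cast hgoodcard
  have h5 : (R * E.card : ℝ) ≤ S.card + R * (26 * C * R * (R + 1) * s ^ 2) := by
    rw [← hEcard', mul_add]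
    gcongr
  calc (K * R * A.card : ℝ) = R * (K * A.card) := by ring
    _ ≤ R * (rothNumberNat K * (S.card + K * E.card)) := by gcongr
    _ = rothNumberNat K * (R * S.card + K * (R * E.card)) := by ring
    _ ≤ rothNumberNat K * (R * S.card + K * (S.card + R * (26 * C * R * (R + 1) * s ^ 2))) := by
        gcongr
    _ = _ := by ring

/-! ### A crude lower bound for the Bohr-type set -/

/-- The sequence gets past the integer `⌈y 0⌉`, and at the first index where it does so it has
overshot by less than one step. -/
theorem exists_fract_lt_of_monotone_steps {y : ℕ → ℝ} {σ : ℝ} {H : ℕ} (hσ : 0 < σ)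
    (hstep : ∀ j < H, y (j + 1) - y j ≤ σ) (htotal : 1 ≤ y H - y 0) :
    ∃ j ≤ H, Int.fract (y j) < σ := by
  classical
  have hex : ∃ j, (⌈y 0⌉ : ℝ) ≤ y j := ⟨H, by linarith [Int.ceil_lt_add_one (y 0)]⟩
  have hH : Nat.find hex ≤ H := Nat.find_min' hex (by linarith [Int.ceil_lt_add_one (y 0)])
  refine ⟨Nat.find hex, hH, ?_⟩
  have hspec := Nat.find_spec hex
  have hlt : y (Nat.find hex) < ⌈y 0⌉ + σ := by
    rcases hj : Nat.find hex with _ | j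
    · linarith [Int.le_ceil (y 0)]
    · have h1 := Nat.find_min hex (m := j) (by omega)
      have h2 := hstep j (by omega)
      linarith [not_le.1 h1]
  have : (⌈y 0⌉ : ℝ) ≤ ⌊y (Nat.find hex)⌋ := by exact_mod_cast Int.le_floor.2 hspec
  rw [Int.fract]
  linarith

theorem exists_fract_lt_of_signed_steps {y : ℕ → ℝ} {κ σ η : ℝ} {H : ℕ} (hκ : |κ| = 1)
    (hσ : 0 < σ) (hupper : ∀ j < H, κ * (y (j + 1) - y j) ≤ σ)
    (hlower : ∀ j < H, η ≤ κ * (y (j + 1) - y j)) (htotal : 1 ≤ H * η) :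
    ∃ j ≤ H, Int.fract (y j) < σ := by
  have hsum : ∀ n ≤ H, n * η ≤ κ * (y n - y 0) := by
    intro n
    induction n with
    | zero => simp
    | succ n ih =>
      intro hn
      have h1 := ih (by omega)
      have h2 := hlower n hn
      push_cast
      linarith
  have hH := hsum H le_rfl
  rcases (abs_eq zero_le_one).1 hκ with rfl | rfl
  · exact exists_fract_lt_of_monotone_steps hσ (fun j hj => by linarith [hupper j hj])
      (by linarith)
  -- A decreasing sequence is read backwards.
  · obtain ⟨j, hj, h⟩ := exists_fract_lt_of_monotone_steps (y := fun j => y (H - j)) (H := H) hσ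
      (fun j hj => by
        have h1 := hupper (H - (j + 1)) (by omega)
        rw [show H - (j + 1) + 1 = H - j by omega] at h1
        show y (H - (j + 1)) - y (H - j) ≤ σ
        linarith) (by simp; linarith)
    exact ⟨H - j, by omega, h⟩

theorem card_ge_of_gaps {S : Finset ℕ} {P M I : ℕ}
    (h : ∀ n, P ≤ n → n + M ≤ P + I * M → ∃ m ∈ S, n ≤ m ∧ m < n + M) : I ≤ S.card := by
  have h' : ∀ i : ℕ, ∃ m, i < I → m ∈ S ∧ P + i * M ≤ m ∧ m < P + i * M + M := by
    intro i
    by_cases hi : i < I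
    · obtain ⟨m, h1, h2⟩ := h (P + i * M) (by omega) (by
        rw [add_assoc, ← Nat.succ_mul]
        gcongr
        omega)
      exact ⟨m, fun _ => ⟨h1, h2⟩⟩
    · exact ⟨0, fun hi' => absurd hi' hi⟩
  choose f hf using h'
  have := Finset.card_le_card_of_injOn (s := Finset.range I) (t := S) f
    (fun i hi => (hf i (Finset.mem_range.1 hi)).1) (by
      have aux : ∀ i j, i < I → j < I → i < j → f i < f j := by
        intro i j hi hj hij
        have h1 := (hf i hi).2.2
        have h2 := (hf j hj).2.1
        have h3 : (i + 1) * M ≤ j * M := by gcongr; omega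
        rw [Nat.succ_mul] at h3
        omega
      intro i hi j hj hij
      simp only [Finset.coe_range, mem_Iio] at hi hj
      rcases lt_trichotomy i j with hlt | heq | hlt
      · have := aux i j hi hj hlt; omega
      · exact heq
      · have := aux j i hj hi hlt; omega)
  simpa using this

namespace IsPhaseOn

variable {κ C s : ℝ} {G g ψ : ℝ → ℝ} {I : Set ℝ}

theorem continuousOn (h : IsPhaseOn κ C s G g ψ I) (hκ : |κ| = 1) (hC : 0 ≤ C) (hs : 0 < s) :
    ContinuousOn g I := by
  have : LipschitzOnWith (C / s ^ 15).toNNReal g I := by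
    refine LipschitzOnWith.of_dist_le_mul fun x hx y hy => ?_
    rw [Real.coe_toNNReal _ (by positivity), Real.dist_eq, Real.dist_eq]
    refine (h.abs_sub_le hκ hs hx hy).trans_eq (by ring)
  exact this.continuousOn

/-- Over `[s ^ 15, 3/2 s ^ 15]` the slope changes by at least `1 / (2 s)`, hence `b g` by at least
`2`, and it takes an integer value. -/
theorem exists_rational_slope (h : IsPhaseOn κ C s G g ψ (Icc (s ^ 15) (2 * s ^ 15)))
    (hκ : |κ| = 1) (hC : 0 ≤ C) (hs : 0 < s) {b : ℝ} (hb : 4 * s ≤ b) :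
    ∃ v ∈ Icc (s ^ 15) (3 / 2 * s ^ 15), ∃ a : ℤ, b * g v = a := by
  have hN : 0 < s ^ 15 := by positivity
  have hsub : Icc (s ^ 15) (3 / 2 * s ^ 15) ⊆ Icc (s ^ 15) (2 * s ^ 15) :=
    Icc_subset_Icc_right (by linarith)
  have hle : s ^ 15 ≤ 3 / 2 * s ^ 15 := by linarith
  have hcont : ContinuousOn (fun t => b * g t) (uIcc (s ^ 15) (3 / 2 * s ^ 15)) := by
    rw [uIcc_of_le hle]
    exact continuousOn_const.mul ((h.continuousOn hκ hC hs).mono hsub)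
  have hgap := h.le_abs_sub hκ (hsub (left_mem_Icc.2 hle)) (hsub (right_mem_Icc.2 hle)) hle
  have hgap' : 1 ≤ |b * g (3 / 2 * s ^ 15) - b * g (s ^ 15)| := by
    rw [← mul_sub, abs_mul, abs_of_pos (by linarith)]
    calc (1 : ℝ) ≤ (4 * s) * ((3 / 2 * s ^ 15 - s ^ 15) / s ^ 16) := by
          rw [show (4 * s) * ((3 / 2 * s ^ 15 - s ^ 15) / s ^ 16) = 2 by field_simp; ring]
          norm_num
      _ ≤ _ := mul_le_mul hb hgap (by
          have : 3 / 2 * s ^ 15 - s ^ 15 = s ^ 15 / 2 := by ring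
          rw [this]; positivity) (by linarith)
  obtain ⟨a, ha⟩ : ∃ a : ℤ, (a : ℝ) ∈ uIcc (b * g (s ^ 15)) (b * g (3 / 2 * s ^ 15)) := by
    rcases le_abs.1 hgap' with h1 | h1
    · refine ⟨⌈b * g (s ^ 15)⌉, ?_⟩
      rw [uIcc_of_le (by linarith)]
      exact ⟨Int.le_ceil _, by linarith [Int.ceil_lt_add_one (b * g (s ^ 15))]⟩
    · refine ⟨⌈b * g (3 / 2 * s ^ 15)⌉, ?_⟩
      rw [uIcc_of_ge (by linarith)]
      exact ⟨Int.le_ceil _, by linarith [Int.ceil_lt_add_one (b * g (3 / 2 * s ^ 15))]⟩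
  obtain ⟨v, hv, hva⟩ := intermediate_value_uIcc hcont ha
  rw [uIcc_of_le hle] at hv
  exact ⟨v, hv, a, hva⟩

theorem card_ge (h : IsPhaseOn κ C s G g ψ (Icc (s ^ 15) (2 * s ^ 15))) (hκ : |κ| = 1)
    (hC : 1 ≤ C) (hs : 22 * C ≤ s) {S : Finset ℕ}
    (hS : ∀ n : ℕ, s ^ 15 ≤ n → (n : ℝ) < 2 * s ^ 15 → Int.fract (G n) < ψ n → n ∈ S) :
    s ^ 7 ≤ S.card := by
  have hs22 : 22 ≤ s := by linarith
  have hs0 : 0 < s := by linarith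
  set b := ⌈4 * s⌉₊ with hb
  have hb4 : 4 * s ≤ b := Nat.le_ceil _
  have hb5 : (b : ℝ) ≤ 5 * s := by linarith [(Nat.ceil_lt_add_one (a := 4 * s) (by linarith))]
  have hb0 : (0 : ℝ) < b := by linarith
  obtain ⟨v, hv, a, hva⟩ := h.exists_rational_slope hκ (by linarith) hs0 hb4
  have hv0 : 0 ≤ v := le_trans (by positivity) hv.1
  have hs12 : 0 < s ^ 12 := by positivity
  have h15 : s ^ 12 * 22 ^ 3 ≤ s ^ 15 := by
    rw [show s ^ 15 = s ^ 12 * s ^ 3 by ring]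
    gcongr
  have hvmem : v ∈ Icc (s ^ 15) (2 * s ^ 15) := ⟨hv.1, by linarith [hv.2]⟩
  have hmem : ∀ t, v ≤ t → t ≤ v + 3 * s ^ 12 → t ∈ Icc (s ^ 15) (2 * s ^ 15) :=
    fun t h1 h2 => ⟨hv.1.trans h1, by linarith [hv.2]⟩
  -- Moving `s ^ 12` to `3 s ^ 12` past `v` makes the increment over `b`, modulo one, positive in
  -- the direction `κ`: small enough not to jump over an arc of length `1 / s`, large enough to go
  -- round the circle in about `s ^ 3` steps.
  have hslope : ∀ t, v + s ^ 12 ≤ t → t ≤ v + 3 * s ^ 12 →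
      1 / s ^ 3 ≤ κ * (b * g t - a) ∧ κ * (b * g t - a) ≤ 1 / s := by
    intro t h1 h2
    have h3 := h.lower v hvmem t (hmem t (by linarith) h2) (by linarith)
    have h4 := h.upper v hvmem t (hmem t (by linarith) h2) (by linarith)
    have h5 : κ * (b * g t - a) = b * (κ * (g t - g v)) := by rw [← hva]; ring
    rw [h5]
    constructor
    · calc 1 / s ^ 3 ≤ (4 * s) * (s ^ 12 / s ^ 16) := by
            rw [show (4 * s) * (s ^ 12 / s ^ 16) = 4 / s ^ 3 by field_simp]
            gcongr
            norm_num
        _ ≤ b * (κ * (g t - g v)) := by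
            refine mul_le_mul hb4 (le_trans ?_ h3) (by positivity) hb0.le
            gcongr
            linarith
    · calc b * (κ * (g t - g v)) ≤ b * (C * (3 * s ^ 12) / s ^ 15) := by
            refine mul_le_mul_of_nonneg_left (h4.trans ?_) hb0.le
            gcongr
            linarith
        _ ≤ (5 * s) * (C * (3 * s ^ 12) / s ^ 15) := by gcongr
        _ = (15 * C) / s * (1 / s) := by field_simp; ring
        _ ≤ 1 * (1 / s) := by
            gcongr
            rw [div_le_one hs0]
            linarith
        _ = 1 / s := one_mul _
  set H := ⌈s ^ 3⌉₊ with hH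
  have hH1 : s ^ 3 ≤ H := Nat.le_ceil _
  have hs3 : 1 ≤ s ^ 3 := one_le_pow₀ (by linarith)
  have hH2 : (H : ℝ) ≤ 2 * s ^ 3 := by
    linarith [(Nat.ceil_lt_add_one (a := s ^ 3) (by positivity))]
  set M := H * b + 1 with hM
  have hM11 : (M : ℝ) ≤ 11 * s ^ 4 := by
    rw [hM]
    push_cast
    have h1 : (H : ℝ) * b ≤ (2 * s ^ 3) * (5 * s) := by gcongr
    have h2 : 1 ≤ s ^ 4 := one_le_pow₀ (by linarith)
    nlinarith
  have hwin : ∀ n : ℕ, v + s ^ 12 ≤ n → (n : ℝ) + M ≤ v + 3 * s ^ 12 →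
      ∃ m ∈ S, n ≤ m ∧ m < n + M := by
    intro n h1 h2
    have h2' : (n : ℝ) + H * b + 1 ≤ v + 3 * s ^ 12 := by
      rw [hM] at h2; push_cast at h2; linarith
    have hjb : ∀ j : ℕ, j ≤ H → (j : ℝ) * b ≤ H * b := fun j hj => by gcongr
    have hjb0 : ∀ j : ℕ, (0 : ℝ) ≤ j * b := fun j => by positivity
    have hinc : ∀ j < H, 1 / s ^ 3 ≤ κ * ((G (n + (j + 1 : ℕ) * b) - (j + 1 : ℕ) * a)
        - (G (n + j * b) - j * a)) ∧ κ * ((G (n + (j + 1 : ℕ) * b) - (j + 1 : ℕ) * a)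
        - (G (n + j * b) - j * a)) ≤ 1 / s := by
      intro j hj
      have h3 := hjb (j + 1) hj
      have h4 : (n : ℝ) + (j + 1 : ℕ) * b = n + j * b + b := by push_cast; ring
      obtain ⟨t, ht, h5⟩ := h.exists_sub_eq (x := n + j * b) (y := n + (j + 1 : ℕ) * b)
        (by rw [h4]; linarith) (by linarith [hv.1, hjb0 j]) (by linarith [hv.2])
      have h6 := hslope t (by linarith [ht.1, hjb0 j]) (by linarith [ht.2])
      have h7 : ((G (n + (j + 1 : ℕ) * b) - (j + 1 : ℕ) * a) - (G (n + j * b) - j * a))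
          = b * g t - a := by
        rw [h4] at h5 ⊢
        push_cast
        linear_combination h5
      rwa [h7]
    obtain ⟨j, hj, hfr⟩ := exists_fract_lt_of_signed_steps (η := 1 / s ^ 3) (σ := 1 / s) (H := H)
      (y := fun j => G (n + j * b) - j * a) hκ (by positivity) (fun j hj => (hinc j hj).2)
      (fun j hj => (hinc j hj).1) (by rw [mul_one_div, le_div_iff₀ (by positivity)]; linarith)
    have hcast : ((n + j * b : ℕ) : ℝ) = n + j * b := by push_cast; ring
    have hr := hjb j hj
    have hrange := hmem (n + j * b) (by linarith [hjb0 j]) (by linarith)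
    refine ⟨n + j * b, hS _ ?_ ?_ ?_, by omega, ?_⟩
    · rw [hcast]; exact hrange.1
    · rw [hcast]; linarith [hv.2]
    · rw [hcast]
      refine lt_of_lt_of_le ?_ (h.width _ hrange)
      have : G (n + j * b) - j * a = G (n + j * b) - ((j * a : ℤ) : ℝ) := by push_cast; rfl
      simp only [this, Int.fract_sub_intCast] at hfr
      exact hfr
    · have : j * b ≤ H * b := by gcongr
      omega
  set P := ⌈v + s ^ 12⌉₊ with hP
  have hP1 : v + s ^ 12 ≤ P := Nat.le_ceil _
  have hP2 := Nat.ceil_lt_add_one (a := v + s ^ 12) (by positivity)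
  -- Disjoint blocks of length `M ≤ 11 s ^ 4` fit this often into a length `s ^ 12`; as `s ≥ 22`,
  -- the count is at least `2 s ^ 7 - 1`.
  set J := ⌊s ^ 8 / 11⌋₊ with hJ
  have hJ1 : (J : ℝ) ≤ s ^ 8 / 11 := Nat.floor_le (by positivity)
  have hJ2 : s ^ 8 / 11 < J + 1 := Nat.lt_floor_add_one _
  have hJM : (J : ℝ) * M ≤ s ^ 12 := by
    calc (J : ℝ) * M ≤ (s ^ 8 / 11) * (11 * s ^ 4) := by gcongr
      _ = s ^ 12 := by ring
  have h1s12 : 1 ≤ s ^ 12 := one_le_pow₀ (by linarith)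
  have hcard : J ≤ S.card := by
    refine card_ge_of_gaps (P := P) (M := M) ?_
    intro n hn hnM
    have h1 : (P : ℝ) ≤ n := by exact_mod_cast hn
    have h2 : (n : ℝ) + M ≤ P + J * M := by exact_mod_cast hnM
    exact hwin n (by linarith) (by linarith)
  have hcard' : (J : ℝ) ≤ S.card := by exact_mod_cast hcard
  have h7 : 1 ≤ s ^ 7 := one_le_pow₀ (by linarith)
  have h8 : 22 * s ^ 7 ≤ s ^ 8 := by
    rw [show s ^ 8 = s * s ^ 7 by ring]
    gcongr
  linarith

end IsPhaseOn

/-! ### From windows to relative density -/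

open Classical in
/-- The number of elements of `A` in `[m, n)`. -/
noncomputable def countIn (A : Set ℕ) (m n : ℕ) : ℕ := ((Finset.Ico m n).filter (· ∈ A)).card

theorem countIn_add (A : Set ℕ) {l m n : ℕ} (h : l ≤ m) (h' : m ≤ n) :
    countIn A l m + countIn A m n = countIn A l n := by
  classical
  rw [countIn, countIn, countIn, ← Finset.card_union_of_disjoint, ← Finset.filter_union,
    Finset.Ico_union_Ico_eq_Ico h h']
  exact Finset.disjoint_filter_filter (Finset.Ico_disjoint_Ico_consecutive l m n)

theorem countIn_le (A : Set ℕ) (m n : ℕ) : countIn A m n ≤ n := by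
  classical
  refine (Finset.card_filter_le _ _).trans ?_
  rw [Nat.card_Ico]
  omega

theorem ncard_inter_Icc (A : Set ℕ) (N : ℕ) : (A ∩ Icc 1 N).ncard = countIn A 1 (N + 1) := by
  classical
  rw [countIn, ← Set.ncard_coe_finset]
  congr 1
  ext n
  simp only [mem_inter_iff, mem_Icc, Finset.coe_filter, Finset.mem_Ico, mem_ofPred_eq]
  constructor
  · rintro ⟨h1, h2, h3⟩; exact ⟨⟨h2, by omega⟩, h1⟩
  · rintro ⟨⟨h2, h3⟩, h1⟩; exact ⟨h1, h2, by omega⟩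

/-- `B` is eventually `{n : {G(n)} < ψ(n)}` for a phase `G` and a width `ψ` that are tame on every
dyadic interval far out. -/
structure IsTameBohrSet (B : Set ℕ) (κ C : ℝ) (G g ψ : ℝ → ℝ) : Prop where
  abs_sign : |κ| = 1
  one_le : 1 ≤ C
  phase : ∀ᶠ s : ℝ in atTop, IsPhaseOn κ C s G g ψ (Icc (s ^ 15) (2 * s ^ 15))
  mem_iff : ∀ᶠ n : ℕ in atTop, n ∈ B ↔ Int.fract (G n) < ψ n

theorem exists_rothNumberNat_le {δ : ℝ} (hδ : 0 < δ) :
    ∃ K : ℕ, 1 ≤ K ∧ (rothNumberNat K : ℝ) ≤ δ * K := by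
  have h := (rothNumberNat_isLittleO_id.bound hδ).and (eventually_ge_atTop 1)
  obtain ⟨K, hK, hK1⟩ := h.exists
  refine ⟨K, hK1, ?_⟩
  simpa using hK

theorem exists_cube_root {x : ℝ} (hx : 0 ≤ x) : ∃ s : ℝ, 0 ≤ s ∧ s ^ 3 = x :=
  ⟨x ^ ((3 : ℝ)⁻¹), by positivity, by
    rw [← Real.rpow_natCast, ← Real.rpow_mul hx]; norm_num⟩

namespace IsTameBohrSet

variable {B A : Set ℕ} {κ C : ℝ} {G g ψ : ℝ → ℝ}

theorem countIn_window_le (h : IsTameBohrSet B κ C G g ψ) (hAB : A ⊆ B) {m : ℕ}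
    (hA : ThreeAPFree (A ∩ Ici m)) {δ : ℝ} (hδ : 0 < δ) :
    ∃ c : ℝ, 0 ≤ c ∧ ∀ᶠ k : ℕ in atTop, ∀ w : ℕ, k ^ 5 ≤ w → w ≤ (k + 1) ^ 5 →
      (countIn A (k ^ 5) w : ℝ) ≤ δ * countIn B (k ^ 5) w + c * k := by
  classical
  obtain ⟨K, hK1, hK⟩ := exists_rothNumberNat_le (half_pos hδ)
  have hK0 : (1 : ℝ) ≤ K := by exact_mod_cast hK1
  have hC := h.one_le
  refine ⟨K * (26 * C * K * (K + 1)), by positivity, ?_⟩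
  obtain ⟨s₀, hs₀⟩ := eventually_atTop.1 h.phase
  obtain ⟨n₀, hn₀⟩ := eventually_atTop.1 h.mem_iff
  set s₁ := max (max s₀ (640 * C * K ^ 2)) 1
  obtain ⟨k₁, hk₁⟩ := exists_nat_ge (s₁ ^ 3)
  filter_upwards [eventually_ge_atTop k₁, eventually_ge_atTop 32, eventually_ge_atTop n₀,
    eventually_ge_atTop m] with k h1 h2 h3 h4 w hw1 hw2
  have hkk : k ≤ k ^ 5 := Nat.le_self_pow (by norm_num) k
  obtain ⟨s, hs0, hs⟩ := exists_cube_root (x := k) (by positivity)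
  have hss : s₁ ≤ s := by
    refine le_of_pow_le_pow_left₀ (n := 3) (by norm_num) hs0 ?_
    rw [hs]
    exact hk₁.trans (by exact_mod_cast h1)
  have hs1 : 1 ≤ s := le_trans (le_max_right _ _) hss
  have hs15 : s ^ 15 = (k ^ 5 : ℕ) := by
    rw [show s ^ 15 = (s ^ 3) ^ 5 by ring, hs]; push_cast; rfl
  have hs12 : s ^ 12 = (k : ℝ) ^ 4 := by
    rw [show s ^ 12 = (s ^ 3) ^ 4 by ring, hs]
  have hsk : s ^ 2 ≤ k := by
    rw [← hs]; exact pow_le_pow_right₀ hs1 (by norm_num)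
  have hk32 : (32 : ℝ) ≤ k := by exact_mod_cast h2
  have hlen : ((k : ℝ) + 1) ^ 5 - k ^ 5 ≤ 32 * k ^ 4 := by
    have e1 : (1 : ℝ) ≤ k := by linarith
    have e2 : (k : ℝ) ^ 3 ≤ k ^ 4 := pow_le_pow_right₀ e1 (by norm_num)
    have e3 : (k : ℝ) ^ 2 ≤ k ^ 4 := pow_le_pow_right₀ e1 (by norm_num)
    have e4 : (k : ℝ) ^ 1 ≤ k ^ 4 := pow_le_pow_right₀ e1 (by norm_num)
    have e5 : (1 : ℝ) ≤ k ^ 4 := one_le_pow₀ e1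
    nlinarith
  have hw2' : (w : ℝ) ≤ (k + 1) ^ 5 := by exact_mod_cast hw2
  have hph := (hs₀ s (le_trans ((le_max_left _ _).trans (le_max_left _ _)) hss)).mono
    (J := Icc ((k ^ 5 : ℕ) : ℝ) w) (by
      rw [hs15]
      refine Icc_subset_Icc_right ?_
      have : 32 * (k : ℝ) ^ 4 ≤ k ^ 5 := by
        rw [show (k : ℝ) ^ 5 = k * k ^ 4 by ring]
        gcongr
      push_cast
      linarith)
  -- The choice `R = K` balances the two terms of the factor `R + K`; the resulting `2 r(K) / K` is
  -- at most `δ`.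
  have hmain := hph.window_bound h.abs_sign hC hK1
    (le_trans ((le_max_right _ _).trans (le_max_left _ _)) hss) hw1 (by
      rw [hs12]; push_cast; linarith)
    (A := (Finset.Ico (k ^ 5) w).filter (· ∈ A)) (S := (Finset.Ico (k ^ 5) w).filter (· ∈ B))
    (by
      intro n
      rw [Finset.mem_filter, Finset.mem_Ico, and_assoc]
      refine and_congr_right fun hn => and_congr_right fun _ => hn₀ n (by omega))
    (Finset.monotone_filter_right _ (fun n _ hn => hAB hn))
    (hA.mono (by
      intro n hn
      simp only [Finset.coe_filter, Finset.mem_Ico, mem_ofPred_eq] at hn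
      exact ⟨hn.2, by simp only [mem_Ici]; omega⟩)) K
  change (K * K * (countIn A (k ^ 5) w : ℝ)) ≤ _ * (countIn B (k ^ 5) w : ℝ) + _ at hmain
  have hrK : (rothNumberNat K : ℝ) ≤ K := by exact_mod_cast rothNumberNat_le K
  set a := (countIn A (k ^ 5) w : ℝ)
  set b := (countIn B (k ^ 5) w : ℝ)
  set r := (rothNumberNat K : ℝ)
  have hb0 : 0 ≤ b := Nat.cast_nonneg _
  have hfin : (K * K : ℝ) * a ≤ (K * K) * (δ * b + K * (26 * C * K * (K + 1)) * k) := by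
    refine hmain.trans ?_
    calc r * (K + K) * b + r * K * K * (26 * C * K * (K + 1) * s ^ 2)
        ≤ (δ / 2 * K) * (K + K) * b + K * K * K * (26 * C * K * (K + 1) * k) := by gcongr
      _ = _ := by ring
  exact le_of_mul_le_mul_left hfin (by positivity)

theorem countIn_le (h : IsTameBohrSet B κ C G g ψ) (hAB : A ⊆ B) {m : ℕ}
    (hA : ThreeAPFree (A ∩ Ici m)) {δ : ℝ} (hδ : 0 < δ) :
    ∃ c c₀ : ℝ, 0 ≤ c ∧ ∀ k w : ℕ, 1 ≤ k → k ^ 5 ≤ w → w ≤ (k + 1) ^ 5 →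
      (countIn A 1 w : ℝ) ≤ δ * countIn B 1 w + c * k ^ 2 + c₀ := by
  obtain ⟨c, hc, hev⟩ := h.countIn_window_le hAB hA hδ
  obtain ⟨k₀, hk₀⟩ := eventually_atTop.1 hev
  set k₁ := max k₀ 1
  have hsplit : ∀ k w : ℕ, k₁ ≤ k → k ^ 5 ≤ w → w ≤ (k + 1) ^ 5 →
      (countIn A 1 w : ℝ) - δ * countIn B 1 w ≤
        (countIn A 1 (k ^ 5) : ℝ) - δ * countIn B 1 (k ^ 5) + c * k := by
    intro k w hk h1 h2
    have h3 := hk₀ k ((le_max_left _ _).trans hk) w h1 h2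
    have h4 : 1 ≤ k ^ 5 := Nat.one_le_pow _ _ ((le_max_right _ _).trans hk)
    rw [← countIn_add A h4 h1, ← countIn_add B h4 h1]
    push_cast
    linarith
  -- Summing the errors `c k` over the windows gives at most `c k ^ 2`; everything below `k₁ ^ 5` is
  -- bounded trivially.
  have hind : ∀ k, k₁ ≤ k → (countIn A 1 (k ^ 5) : ℝ) - δ * countIn B 1 (k ^ 5) ≤
      (k₁ ^ 5 : ℕ) + c * k ^ 2 := by
    intro k hk
    induction k, hk using Nat.le_induction with
    | base =>
      have h1 : (countIn A 1 (k₁ ^ 5) : ℝ) ≤ (k₁ ^ 5 : ℕ) := by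
        exact_mod_cast ThinRoth.countIn_le A 1 (k₁ ^ 5)
      have h2 : (0 : ℝ) ≤ δ * countIn B 1 (k₁ ^ 5) := by positivity
      have h3 : 0 ≤ c * (k₁ : ℝ) ^ 2 := by positivity
      linarith
    | succ k hk ih =>
      have h1 := hsplit k ((k + 1) ^ 5) hk (by gcongr; omega) le_rfl
      have h2 : 0 ≤ c * k := by positivity
      push_cast
      push_cast at ih
      nlinarith
  refine ⟨2 * c, (k₁ ^ 5 : ℕ), by positivity, ?_⟩
  intro k w hk1 h1 h2
  have hB0 : (0 : ℝ) ≤ δ * countIn B 1 w := by positivity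
  have hcsq : c * (k : ℝ) ≤ c * k ^ 2 := by
    gcongr
    have : (1 : ℝ) ≤ k := by exact_mod_cast hk1
    nlinarith
  have hck : 0 ≤ c * (k : ℝ) := by positivity
  rcases le_or_gt k₁ k with hk | hk
  · have h3 := hsplit k w hk h1 h2
    have h4 := hind k hk
    linarith
  · have h3 : w ≤ k₁ ^ 5 := h2.trans (by gcongr; omega)
    have h4 : (countIn A 1 w : ℝ) ≤ (k₁ ^ 5 : ℕ) := by
      exact_mod_cast (ThinRoth.countIn_le A 1 w).trans h3
    linarith

theorem le_countIn (h : IsTameBohrSet B κ C G g ψ) :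
    ∀ᶠ s : ℝ in atTop, ∀ w : ℕ, 2 * s ^ 15 ≤ w → s ^ 7 ≤ (countIn B 1 w : ℝ) := by
  classical
  obtain ⟨n₀, hn₀⟩ := eventually_atTop.1 h.mem_iff
  filter_upwards [h.phase, eventually_ge_atTop (22 * C), eventually_ge_atTop (1 : ℝ),
    eventually_ge_atTop (n₀ : ℝ)] with s hph hs h1 h2 w hw
  refine hph.card_ge h.abs_sign h.one_le hs ?_
  intro n hn1 hn2 hfr
  have h3 : s ≤ s ^ 15 := le_self_pow₀ h1 (by norm_num)
  have h4 : n₀ ≤ n := by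
    have : (n₀ : ℝ) ≤ n := by linarith
    exact_mod_cast this
  rw [Finset.mem_filter, Finset.mem_Ico, hn₀ n h4]
  refine ⟨⟨?_, ?_⟩, hfr⟩
  · have : (1 : ℝ) ≤ n := by linarith
    exact_mod_cast this
  · have : (n : ℝ) < w := by linarith
    exact_mod_cast this

theorem eventually_countIn_le (h : IsTameBohrSet B κ C G g ψ) (hAB : A ⊆ B) {m : ℕ}
    (hA : ThreeAPFree (A ∩ Ici m)) {δ : ℝ} (hδ : 0 < δ) :
    ∀ᶠ w : ℕ in atTop, (countIn A 1 w : ℝ) ≤ δ * countIn B 1 w := by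
  obtain ⟨c, c₀, hc, hle⟩ := h.countIn_le hAB hA (half_pos hδ)
  have hlim : ∀ᶠ s : ℝ in atTop, 4 * c * s ^ 6 + c₀ ≤ δ / 2 * s ^ 7 := by
    filter_upwards [eventually_ge_atTop ((4 * c + |c₀|) / (δ / 2)), eventually_ge_atTop 1]
      with s h1 h2
    rw [div_le_iff₀ (by positivity)] at h1
    have h3 : 1 ≤ s ^ 6 := one_le_pow₀ h2
    calc 4 * c * s ^ 6 + c₀ ≤ 4 * c * s ^ 6 + |c₀| * s ^ 6 := by
          gcongr
          exact (le_abs_self _).trans (le_mul_of_one_le_right (abs_nonneg _) h3)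
      _ = (4 * c + |c₀|) * s ^ 6 := by ring
      _ ≤ (s * (δ / 2)) * s ^ 6 := by gcongr
      _ = _ := by ring
  obtain ⟨s₀, hs₀⟩ := eventually_atTop.1 (hlim.and h.le_countIn)
  obtain ⟨w₀, hw₀⟩ := exists_nat_ge (2 * (max s₀ 1) ^ 15)
  filter_upwards [eventually_ge_atTop w₀, eventually_ge_atTop 1] with w hw hw1
  -- With `w = 2 s ^ 15` the block `[s ^ 15, 2 s ^ 15)` lies below `w`, and `k ^ 5 ≤ w` gives `k ≤ 2
  -- s ^ 3`.
  obtain ⟨s, hs0, hs⟩ : ∃ s : ℝ, 0 ≤ s ∧ s ^ 15 = w / 2 :=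
    ⟨((w : ℝ) / 2) ^ ((15 : ℝ)⁻¹), by positivity, by
      rw [← Real.rpow_natCast, ← Real.rpow_mul (by positivity)]; norm_num⟩
  have hss : max s₀ 1 ≤ s := by
    refine le_of_pow_le_pow_left₀ (n := 15) (by norm_num) hs0 ?_
    have : (w₀ : ℝ) ≤ w := by exact_mod_cast hw
    rw [hs]
    linarith
  obtain ⟨hs1, hs2⟩ := hs₀ s ((le_max_left _ _).trans hss)
  have hs3 := hs2 w (by linarith)
  obtain ⟨k, hk1, hk2, hk3⟩ : ∃ k : ℕ, 1 ≤ k ∧ k ^ 5 ≤ w ∧ w ≤ (k + 1) ^ 5 := by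
    classical
    have hex : ∃ k : ℕ, w ≤ (k + 1) ^ 5 :=
      ⟨w, (Nat.le_succ w).trans (Nat.le_self_pow (by norm_num) _)⟩
    rcases Nat.eq_zero_or_pos (Nat.find hex) with h0 | hpos
    · have := Nat.find_spec hex
      rw [h0] at this
      exact ⟨1, le_rfl, by simpa using hw1, this.trans (by norm_num)⟩
    · have := Nat.find_min hex (m := Nat.find hex - 1) (by omega)
      rw [Nat.sub_add_cancel hpos] at this
      exact ⟨Nat.find hex, hpos, by omega, Nat.find_spec hex⟩
  have hmain := hle k w hk1 hk2 hk3
  have hk : (k : ℝ) ^ 2 ≤ 4 * s ^ 6 := by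
    have h1 : (k : ℝ) ≤ 2 * s ^ 3 := by
      refine le_of_pow_le_pow_left₀ (n := 5) (by norm_num) (by positivity) ?_
      have h2 : (k : ℝ) ^ 5 ≤ w := by exact_mod_cast hk2
      have h3 : (2 * s ^ 3) ^ 5 = 32 * s ^ 15 := by ring
      rw [h3, hs]
      have : (0 : ℝ) ≤ w := by positivity
      linarith
    calc (k : ℝ) ^ 2 ≤ (2 * s ^ 3) ^ 2 := by gcongr
      _ = _ := by ring
  have hck : c * (k : ℝ) ^ 2 ≤ c * (4 * s ^ 6) := by gcongr
  have hB : δ / 2 * s ^ 7 ≤ δ / 2 * countIn B 1 w := by gcongr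
  linarith

theorem relUpperDensity_nonpos (h : IsTameBohrSet B κ C G g ψ) (hAB : A ⊆ B) {m : ℕ}
    (hA : ThreeAPFree (A ∩ Ici m)) : relUpperDensity A B ≤ 0 := by
  refine le_of_forall_pos_le_add fun δ hδ => ?_
  rw [zero_add]
  refine limsup_le_of_le ?_ ?_
  · refine IsBoundedUnder.isCoboundedUnder_le ⟨0, ?_⟩
    rw [eventually_map]
    exact Eventually.of_forall fun N => by positivity
  · have := (tendsto_add_atTop_nat 1).eventually (h.eventually_countIn_le hAB hA hδ)
    filter_upwards [this] with N hN
    rw [ncard_inter_Icc, ncard_inter_Icc]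
    exact div_le_of_le_mul₀ (Nat.cast_nonneg _) hδ.le hN

/-- If there were finitely many progressions, removing from `A` everything up to their largest first
term would leave a progression-free set, whose relative density is zero. -/
theorem infinite_nontrivialThreeAPs (h : IsTameBohrSet B κ C G g ψ) (hAB : A ⊆ B)
    (hpos : 0 < relUpperDensity A B) : (nontrivialThreeAPs A).Infinite := by
  intro hfin
  obtain ⟨m, hm⟩ := (hfin.image Prod.fst).bddAbove
  have hnot : ∀ a b c : ℕ, m < a → a ∈ A → b ∈ A → c ∈ A → a + c = b + b → ¬ a < b := by
    intro a b c hma ha hb hc habc hlt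
    have : a ≤ m := hm ⟨(a, b - a), ⟨by simp; omega, ha, ?_, ?_⟩, rfl⟩
    · omega
    · simpa [Nat.add_sub_cancel' hlt.le] using hb
    · have : a + 2 * (b - a) = c := by omega
      simpa [this] using hc
  refine (h.relUpperDensity_nonpos hAB (m := m + 1) ?_).not_gt hpos
  rintro a ⟨ha, hma⟩ b ⟨hb, -⟩ c ⟨hc, hmc⟩ habc
  -- `ThreeAPFree` does not order the two outer terms, so both orientations are excluded.
  rw [mem_Ici] at hma hmc
  have h1 := hnot a b c (by omega) ha hb hc habc
  have h2 := hnot c b a (by omega) hc hb ha (by omega)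
  omega

end IsTameBohrSet

/-! ### Regularly varying functions and their first two derivatives -/

theorem eventually_rpow_le_const_mul {a b K : ℝ} (hab : a < b) (hK : 0 < K) :
    ∀ᶠ x : ℝ in atTop, x ^ a ≤ K * x ^ b := by
  filter_upwards [(tendsto_rpow_atTop (sub_pos.2 hab)).eventually_ge_atTop K⁻¹,
    eventually_gt_atTop 0] with x hx hx0
  have h1 : x ^ b = x ^ (b - a) * x ^ a := by rw [← Real.rpow_add hx0]; congr 1; ring
  have h2 : 0 < x ^ a := Real.rpow_pos_of_pos hx0 a
  calc x ^ a = K * (K⁻¹ * x ^ a) := by field_simp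
    _ ≤ K * (x ^ (b - a) * x ^ a) := by gcongr
    _ = _ := by rw [h1]

/-- This treats `c = 1` and `c > 1` together. The expression bounded below is `x ^ 2 h'' / h`. It
tends to `c (c - 1) > 0` if `c > 1`; if `c = 1` it is at least `ϑ / 2` far out, since `x ϑ'` is
small against `ϑ`, and `ϑ` decays more slowly than any power. -/
theorem IsRegularlyVarying.exists_exponent {c x₀ : ℝ} {h : ℝ → ℝ} (hc : 1 ≤ c)
    (hh : IsRegularlyVarying c x₀ h) :
    ∃ ϑ : ℝ → ℝ, ContDiffOn ℝ 2 ϑ (Ici x₀) ∧ Tendsto ϑ atTop (nhds 0) ∧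
      Tendsto (fun x => x * deriv ϑ x) atTop (nhds 0) ∧
      (∀ ε : ℝ, 0 < ε → ∀ᶠ x in atTop,
        x ^ (-ε) ≤ (c + ϑ x) * (c - 1 + ϑ x) + x * deriv ϑ x) ∧
      ∀ x, x₀ ≤ x → h x = x ^ c * Real.exp (∫ t in x₀..x, ϑ t / t) := by
  obtain ⟨-, -, -, -, ℓ, ⟨-, ϑ, hϑ, hlim, hlim', -, hexp⟩, hzero, hform⟩ := hh
  rcases hc.eq_or_lt with rfl | hc1
  · obtain ⟨-, -, ϑ, hϑ, hpos, -, hlim, hlim', -, hlow, hexp⟩ := hzero rfl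
    have hpos' : ∀ᶠ x in atTop, 0 < ϑ x := (eventually_ge_atTop x₀).mono hpos
    refine ⟨ϑ, hϑ, hlim, ?_, ?_, fun x hx => by rw [hform x hx, hexp x hx]⟩
    · have := hlim'.mul hlim
      rw [zero_mul] at this
      refine this.congr' ?_
      filter_upwards [hpos'] with x hx
      field_simp
    · intro ε hε
      obtain ⟨C, hC, hCx⟩ := hlow (ε / 2) (half_pos hε)
      filter_upwards [hpos', hlim'.eventually (lt_mem_nhds (show -(1 / 2 : ℝ) < 0 by norm_num)),
        eventually_ge_atTop x₀, eventually_rpow_le_const_mul (show -ε < -(ε / 2) by linarith)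
        (half_pos hC)] with x h1 h2 h3 h4
      rw [lt_div_iff₀ h1] at h2
      have h5 := hCx x h3
      nlinarith
  · refine ⟨ϑ, hϑ, hlim, hlim', ?_, fun x hx => by rw [hform x hx, hexp x hx]⟩
    intro ε hε
    have h1 : Tendsto (fun x => (c + ϑ x) * (c - 1 + ϑ x) + x * deriv ϑ x) atTop
        (nhds ((c + 0) * (c - 1 + 0) + 0)) :=
      ((hlim.const_add c).mul (hlim.const_add (c - 1))).add hlim'
    have h2 : (0 : ℝ) < (c + 0) * (c - 1 + 0) + 0 := by nlinarith
    filter_upwards [h1.eventually (lt_mem_nhds (half_lt_self h2)),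
      (tendsto_rpow_neg_atTop hε).eventually (gt_mem_nhds (half_pos h2))] with x h3 h4
    exact (h4.trans h3).le

theorem hasDerivAt_rpow_mul_exp {c x₀ : ℝ} {h ϑ : ℝ → ℝ} (hx₀ : 1 ≤ x₀)
    (hϑ : ContDiffOn ℝ 2 ϑ (Ici x₀))
    (hform : ∀ x, x₀ ≤ x → h x = x ^ c * Real.exp (∫ t in x₀..x, ϑ t / t)) {x : ℝ} (hx : x₀ < x) :
    HasDerivAt h (h x * (c + ϑ x) / x) x ∧ HasDerivAt ϑ (deriv ϑ x) x := by
  have hx0 : 0 < x := by linarith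
  have hcont : ContinuousOn (fun t => ϑ t / t) (Ici x₀) :=
    hϑ.continuousOn.div continuousOn_id fun t ht => by
      have : x₀ ≤ t := ht
      exact (show (0 : ℝ) < t by linarith).ne'
  have hnhds : Ici x₀ ∈ nhds x := Ici_mem_nhds hx
  have hint : HasDerivAt (fun x => ∫ t in x₀..x, ϑ t / t) (ϑ x / x) x := by
    refine intervalIntegral.integral_hasDerivAt_right ?_ ?_ (hcont.continuousAt hnhds)
    · refine (hcont.mono ?_).intervalIntegrable
      rw [uIcc_of_le hx.le]
      exact Icc_subset_Ici_self
    · refine ContinuousOn.stronglyMeasurableAtFilter isOpen_Ioi (hcont.mono Ioi_subset_Ici_self) x hx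
  constructor
  · have h1 := (Real.hasDerivAt_rpow_const (x := x) (p := c) (Or.inl hx0.ne')).mul hint.exp
    have h2 := h1.congr_of_eventuallyEq (f₁ := h) (by
      filter_upwards [hnhds] with y hy using hform y hy)
    refine h2.congr_deriv ?_
    rw [hform x hx.le, Real.rpow_sub_one hx0.ne']
    field_simp
  · exact ((hϑ.contDiffAt hnhds).differentiableAt (by norm_num)).hasDerivAt

/-- Far out, `p` and `p₂` are the first two derivatives of `h`, with the size that is expected for a
function that is close to linear. -/
structure IsNearlyLinear (h p p₂ : ℝ → ℝ) (x : ℝ) : Prop where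
  deriv : HasDerivAt h (p x) x
  deriv₂ : HasDerivAt p (p₂ x) x
  one_le : 1 ≤ x
  le_self : x ≤ h x
  self_le : h x ≤ x ^ (16 / 15 : ℝ)
  le_deriv : h x / (2 * x) ≤ p x
  deriv_le : p x ≤ 2 * h x / x
  le_deriv₂ : x ^ (-(1 / 480) : ℝ) * h x / x ^ 2 ≤ p₂ x
  deriv₂_le : p₂ x ≤ 4 * h x / x ^ 2

theorem IsRegularlyVarying.eventually_isNearlyLinear {c x₀ : ℝ} {h : ℝ → ℝ} (hc : 1 ≤ c)
    (hc' : c < 16 / 15) (hh : IsRegularlyVarying c x₀ h) :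
    ∃ p p₂ : ℝ → ℝ, ∀ᶠ x in atTop, IsNearlyLinear h p p₂ x := by
  obtain ⟨ϑ, hϑ, hlim, hlim', hlow, hform⟩ := hh.exists_exponent hc
  have hx₀ := hh.1
  have h1le := hh.2.1
  have hder : ∀ x, x₀ < x → HasDerivAt h (h x * (c + ϑ x) / x) x ∧ HasDerivAt ϑ (deriv ϑ x) x :=
    fun x hx => hasDerivAt_rpow_mul_exp hx₀ hϑ hform hx
  have hself : ∀ x, x₀ ≤ x → x ≤ h x := by
    intro x hx
    obtain ⟨-, -, -, -, ℓ, ⟨hℓ, -⟩, -, hℓform⟩ := hh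
    rw [hℓform x hx]
    have h1 : x ^ (1 : ℝ) ≤ x ^ c := Real.rpow_le_rpow_of_exponent_le (hx₀.trans hx) hc
    rw [Real.rpow_one] at h1
    nlinarith [hℓ x hx]
  have hupper : ∀ᶠ x in atTop, h x ≤ x ^ (16 / 15 : ℝ) := by
    -- For `r` strictly between `c` and `16 / 15`, the quotient `h / x ^ r` is eventually
    -- decreasing, and the remaining power absorbs its bound.
    set r := (c + 16 / 15) / 2 with hr
    obtain ⟨X, hX⟩ := eventually_atTop.1 ((hlim.eventually (gt_mem_nhds
      (show (0 : ℝ) < r - c by linarith))).and (eventually_gt_atTop x₀))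
    have hd : ∀ x, X ≤ x → HasDerivAt (fun x => h x * x ^ (-r))
        (h x * (c + ϑ x) / x * x ^ (-r) + h x * (-r * x ^ (-r - 1))) x := fun x hx =>
      (hder x (hX x hx).2).1.mul
        (Real.hasDerivAt_rpow_const (Or.inl (by linarith [(hX x hx).2])))
    have hanti : AntitoneOn (fun x => h x * x ^ (-r)) (Ici X) := by
      refine antitoneOn_of_deriv_nonpos (convex_Ici X)
        (fun x hx => (hd x hx).continuousAt.continuousWithinAt)
        (fun x hx => (hd x (interior_subset hx)).differentiableAt.differentiableWithinAt) ?_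
      intro x hx
      have hx' : X ≤ x := interior_subset hx
      have hx0 : 0 < x := by linarith [(hX x hx').2]
      rw [(hd x hx').deriv, Real.rpow_sub_one hx0.ne']
      have h2 : h x * (c + ϑ x) / x * x ^ (-r) + h x * (-r * (x ^ (-r) / x))
          = h x * x ^ (-r) / x * (c + ϑ x - r) := by ring
      rw [h2]
      have h3 : 0 ≤ h x := by linarith [h1le x (hX x hx').2.le]
      refine mul_nonpos_of_nonneg_of_nonpos ?_ (by linarith [(hX x hx').1])
      positivity
    have hX0 : 0 < X := by linarith [(hX X le_rfl).2]
    have hK : 0 < h X * X ^ (-r) := by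
      have := h1le X (hX X le_rfl).2.le
      positivity
    filter_upwards [eventually_ge_atTop X,
      eventually_rpow_le_const_mul (show r < 16 / 15 by linarith) (inv_pos.2 hK)] with x h2 h3
    have h4 : h x * x ^ (-r) ≤ h X * X ^ (-r) := hanti (mem_Ici.2 le_rfl) h2 h2
    have hx0 : 0 < x := hX0.trans_le h2
    have hxr : 0 < x ^ r := by positivity
    rw [Real.rpow_neg hx0.le, ← div_eq_mul_inv, div_le_iff₀ hxr] at h4
    refine h4.trans ?_
    calc h X * X ^ (-r) * x ^ r ≤ h X * X ^ (-r) * ((h X * X ^ (-r))⁻¹ * x ^ (16 / 15 : ℝ)) := by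
          gcongr
      _ = _ := by rw [← mul_assoc, mul_inv_cancel₀ hK.ne', one_mul]
  refine ⟨fun x => h x * (c + ϑ x) / x,
    fun x => h x * ((c + ϑ x) * (c - 1 + ϑ x) + x * deriv ϑ x) / x ^ 2, ?_⟩
  filter_upwards [eventually_gt_atTop x₀, hupper, hlow (1 / 480) (by norm_num),
    hlim.eventually (Ioo_mem_nhds (show -(1 / 2 : ℝ) < 0 by norm_num)
      (show (0 : ℝ) < 1 / 2 by norm_num)),
    hlim'.eventually (gt_mem_nhds (show (0 : ℝ) < 1 by norm_num))] with x h1 h2 h3 h4 h5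
  obtain ⟨h4l, h4r⟩ := h4
  have hx0 : 0 < x := by linarith
  have hhx : 0 < h x := by linarith [h1le x h1.le]
  obtain ⟨d1, d2⟩ := hder x h1
  refine ⟨d1, ?_, by linarith, hself x h1.le, h2, ?_, ?_, ?_, ?_⟩
  · refine ((d1.mul (d2.const_add c)).div (hasDerivAt_id' x) hx0.ne').congr_deriv ?_
    simp only [Pi.mul_apply]
    field_simp
    ring
  · rw [div_le_div_iff₀ (by positivity) hx0]
    have : 0 < h x * x := by positivity
    nlinarith
  · rw [mul_comm 2]
    gcongr
    linarith
  · rw [mul_comm]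
    gcongr
  · rw [mul_comm 4]
    gcongr
    nlinarith

/-! ### The inverse function and its first two derivatives -/

section Inverse

variable {x₀ X : ℝ} {h : ℝ → ℝ}

theorem inverse_apply (hmono : StrictMonoOn h (Ici x₀)) {x : ℝ} (hx : x₀ ≤ x) :
    inverse x₀ h (h x) = x := hmono.injOn.leftInvOn_invFunOn hx

theorem inverse_spec (hmono : StrictMonoOn h (Ici x₀)) (hX : x₀ ≤ X)
    (hcont : ContinuousOn h (Ici X)) (hle : ∀ x, X ≤ x → x ≤ h x) {y : ℝ} (hy : h X ≤ y) :
    X ≤ inverse x₀ h y ∧ h (inverse x₀ h y) = y := by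
  have hmax : X ≤ max X y := le_max_left _ _
  obtain ⟨x, hx, rfl⟩ := intermediate_value_Icc hmax (hcont.mono Icc_subset_Ici_self)
    ⟨hy, (le_max_right _ _).trans (hle _ hmax)⟩
  rw [inverse_apply hmono (hX.trans hx.1)]
  exact ⟨hx.1, rfl⟩

theorem continuousAt_inverse (hmono : StrictMonoOn h (Ici x₀)) (hX : x₀ ≤ X)
    (hcont : ContinuousOn h (Ici X)) (hle : ∀ x, X ≤ x → x ≤ h x) {y : ℝ} (hy : h X < y) :
    ContinuousAt (inverse x₀ h) y := by
  have hspec : ∀ z, h X < z → X < inverse x₀ h z ∧ h (inverse x₀ h z) = z := by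
    intro z hz
    obtain ⟨h1, h2⟩ := inverse_spec hmono hX hcont hle hz.le
    refine ⟨h1.lt_of_ne ?_, h2⟩
    rintro heq
    rw [← heq] at h2
    exact hz.ne h2
  have hstrict : StrictMonoOn (inverse x₀ h) (Ioi (h X)) := by
    intro a ha b hb hab
    by_contra! hcon
    have := hmono.monotoneOn (hX.trans (hspec b hb).1.le) (hX.trans (hspec a ha).1.le) hcon
    rw [(hspec a ha).2, (hspec b hb).2] at this
    exact this.not_gt hab
  refine hstrict.continuousAt_of_image_mem_nhds (Ioi_mem_nhds hy) ?_
  refine mem_of_superset (Ioi_mem_nhds (hspec y hy).1) ?_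
  intro x hx
  exact ⟨h x, hmono hX (hX.trans (le_of_lt hx)) hx, inverse_apply hmono (hX.trans (le_of_lt hx))⟩

end Inverse

/-- Far out, `g` and `g₂` are the first two derivatives of `φ`, with the expected size for the
inverse of a nearly linear function. -/
structure IsNearlyLinearInverse (φ g g₂ : ℝ → ℝ) (y : ℝ) : Prop where
  deriv : HasDerivAt φ (g y) y
  deriv₂ : HasDerivAt g (g₂ y) y
  le_deriv : 4 * y ^ (-(1 / 15) : ℝ) ≤ g y
  le_neg_deriv₂ : 4 * y ^ (-(16 / 15) : ℝ) ≤ -g₂ y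
  neg_deriv₂_le : -g₂ y ≤ 32 / y

theorem IsRegularlyVarying.eventually_inverse {c x₀ : ℝ} {h : ℝ → ℝ} (hc : 1 ≤ c)
    (hc' : c < 16 / 15) (hh : IsRegularlyVarying c x₀ h) :
    ∃ g g₂ : ℝ → ℝ, ∀ᶠ y in atTop, IsNearlyLinearInverse (inverse x₀ h) g g₂ y := by
  obtain ⟨p, p₂, hev⟩ := hh.eventually_isNearlyLinear hc hc'
  obtain ⟨X, hX⟩ := eventually_atTop.1 (hev.and (eventually_ge_atTop x₀))
  have hmono := hh.2.2.1
  have hXx₀ : x₀ ≤ X := (hX X le_rfl).2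
  have hcont : ContinuousOn h (Ici X) := fun x hx =>
    (hX x hx).1.deriv.continuousAt.continuousWithinAt
  have hle : ∀ x, X ≤ x → x ≤ h x := fun x hx => (hX x hx).1.le_self
  set φ := inverse x₀ h with hφ
  have hφder : ∀ y, h X < y → HasDerivAt φ (p (φ y))⁻¹ y := by
    intro y hy
    obtain ⟨h1, h2⟩ := inverse_spec hmono hXx₀ hcont hle hy.le
    have h3 := (hX _ h1).1
    have hp : 0 < p (φ y) := by
      refine lt_of_lt_of_le ?_ h3.le_deriv
      have := h3.one_le
      have := h3.le_self
      have : 0 < h (φ y) := by linarith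
      have : 0 < φ y := by linarith [h3.one_le]
      positivity
    refine HasDerivAt.of_local_left_inverse (continuousAt_inverse hmono hXx₀ hcont hle hy)
      h3.deriv hp.ne' ?_
    filter_upwards [Ioi_mem_nhds hy] with z hz
    exact (inverse_spec hmono hXx₀ hcont hle (le_of_lt hz)).2
  refine ⟨fun y => (p (φ y))⁻¹, fun y => -(p₂ (φ y) * (p (φ y))⁻¹) / p (φ y) ^ 2, ?_⟩
  -- Since `h x ≤ x ^ (16/15)`, the preimage of `y` is at least `y ^ (15/16)`. This gives the
  -- exponents `15/16 - 1 = -1/16` and `15/16 - 1/480 - 2 = -511/480`; the room left up to `-1/15`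
  -- and `-16/15` absorbs the constants.
  filter_upwards [eventually_gt_atTop (h X),
    eventually_rpow_le_const_mul (show (-(1 / 15) : ℝ) < -(1 / 16) by norm_num)
      (show (0 : ℝ) < 1 / 8 by norm_num),
    eventually_rpow_le_const_mul (show (-(16 / 15) : ℝ) < -(511 / 480) by norm_num)
      (show (0 : ℝ) < 1 / 32 by norm_num)] with y hy hy1 hy2
  obtain ⟨h1, h2⟩ : X ≤ φ y ∧ h (φ y) = y := inverse_spec hmono hXx₀ hcont hle hy.le
  have hφd := hφder y hy
  obtain ⟨-, hd2, hx1, hxy, hyx, l1, l2, l3, l4⟩ := (hX _ h1).1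
  rw [h2] at hxy hyx l1 l2 l3 l4
  generalize hxdef : φ y = x at *
  have hx0 : 0 < x := by linarith
  have hy0 : 0 < y := by linarith
  have hp : 0 < p x := lt_of_lt_of_le (by positivity) l1
  have hp₂ : 0 < p₂ x := lt_of_lt_of_le (by positivity) l3
  have hxlow : y ^ (15 / 16 : ℝ) ≤ x := by
    calc y ^ (15 / 16 : ℝ) ≤ (x ^ (16 / 15 : ℝ)) ^ (15 / 16 : ℝ) := by gcongr
      _ = x := by rw [← Real.rpow_mul hx0.le]; norm_num
  have e1 : y ^ (-(1 / 16) : ℝ) = y ^ (15 / 16 : ℝ) / y := by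
    rw [← Real.rpow_sub_one hy0.ne']; norm_num
  have e2 : y ^ (-(511 / 480) : ℝ) = y ^ (-(1 / 480) : ℝ) * y ^ (15 / 16 : ℝ) / y ^ 2 := by
    rw [← Real.rpow_natCast y 2, ← Real.rpow_add hy0, ← Real.rpow_sub hy0]; norm_num
  have hε : y ^ (-(1 / 480) : ℝ) ≤ x ^ (-(1 / 480) : ℝ) :=
    Real.rpow_le_rpow_of_nonpos hx0 hxy (by norm_num)
  have hneg : -(-(p₂ x * (p x)⁻¹) / p x ^ 2) = p₂ x / p x ^ 3 := by
    field_simp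
  refine ⟨hxdef ▸ hφd, ?_, ?_, ?_, ?_⟩
  · have := (hd2.comp_of_eq y hφd hxdef.symm).inv (by simpa [hxdef] using hp.ne')
    refine this.congr_deriv ?_
    simp only [Function.comp_apply, hxdef]
  · simp only [hxdef]
    calc 4 * y ^ (-(1 / 15) : ℝ) ≤ 4 * (1 / 8 * y ^ (-(1 / 16) : ℝ)) := by gcongr
      _ = (y ^ (15 / 16 : ℝ) / y) / 2 := by rw [e1]; ring
      _ ≤ (x / y) / 2 := by gcongr
      _ = (2 * y / x)⁻¹ := by field_simp
      _ ≤ (p x)⁻¹ := inv_anti₀ hp l2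
  · simp only [hxdef]
    rw [hneg]
    calc 4 * y ^ (-(16 / 15) : ℝ) ≤ 4 * (1 / 32 * y ^ (-(511 / 480) : ℝ)) := by gcongr
      _ = (y ^ (-(1 / 480) : ℝ) * y ^ (15 / 16 : ℝ) / y ^ 2) / 8 := by rw [e2]; ring
      _ ≤ (x ^ (-(1 / 480) : ℝ) * x / y ^ 2) / 8 := by gcongr
      _ = (x ^ (-(1 / 480) : ℝ) * y / x ^ 2) / (2 * y / x) ^ 3 := by field_simp; norm_num
      _ ≤ p₂ x / p x ^ 3 := by gcongr
  · simp only [hxdef]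
    rw [hneg]
    calc p₂ x / p x ^ 3 ≤ (4 * y / x ^ 2) / (y / (2 * x)) ^ 3 := by gcongr
      _ = 32 * x / y ^ 2 := by field_simp; norm_num
      _ ≤ 32 * y / y ^ 2 := by gcongr
      _ = 32 / y := by field_simp

/-! ### Verification of the phase conditions -/

theorem Eventually.eventually_nhds_atTop {P : ℝ → Prop} (h : ∀ᶠ y in atTop, P y) :
    ∀ᶠ y in atTop, ∀ᶠ z in nhds y, P z := by
  obtain ⟨Y, hY⟩ := eventually_atTop.1 h
  filter_upwards [eventually_gt_atTop Y] with y hy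
  filter_upwards [Ioi_mem_nhds hy] with z hz using hY z (le_of_lt hz)

theorem IsWidthFor.eventually_bounds {φ ψ g g₂ : ℝ → ℝ} (hψ : IsWidthFor φ ψ)
    (hφ : ∀ᶠ y in atTop, IsNearlyLinearInverse φ g g₂ y) :
    ∀ᶠ y in atTop, 2 * y ^ (-(1 / 15) : ℝ) ≤ ψ y ∧ DifferentiableAt ℝ ψ y ∧
      |deriv ψ y| ≤ 64 / y := by
  obtain ⟨-, hC, h0, h1, -⟩ := hψ
  have hd : ∀ᶠ y in atTop, ∀ᶠ z in nhds y, deriv φ z = g z :=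
    Eventually.eventually_nhds_atTop (hφ.mono fun y hy => hy.deriv.deriv)
  filter_upwards [hφ, hd, h0.isLittleO.bound (show (0 : ℝ) < 1 / 2 by norm_num),
    h1.isLittleO.bound one_pos, eventually_gt_atTop 1] with y hy hdy b0 b1 hy1
  have hy0 : 0 < y := by linarith
  have hg0 : 0 < g y := lt_of_lt_of_le (by positivity) hy.le_deriv
  have hg2 : iteratedDeriv 2 φ y = g₂ y := by
    rw [iteratedDeriv_succ, iteratedDeriv_one]
    have : deriv φ =ᶠ[nhds y] g := hdy
    rw [this.deriv_eq, hy.deriv₂.deriv]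
  simp only [Pi.sub_apply, Real.norm_eq_abs, hdy.self_of_nhds, hg2] at b0 b1
  refine ⟨?_, (hC.contDiffAt (Ici_mem_nhds hy1)).differentiableAt (by norm_num), ?_⟩
  · rw [abs_of_pos hg0] at b0
    have := (abs_le.1 b0).1
    linarith [hy.le_deriv]
  · have h2 : |g₂ y| ≤ 32 / y := by
      rw [abs_le]
      have h3 : 0 ≤ 4 * y ^ (-(16 / 15) : ℝ) := by positivity
      have h4 : 0 ≤ 32 / y := by positivity
      constructor <;> linarith [hy.le_neg_deriv₂, hy.neg_deriv₂_le]
    have h3 := abs_sub_abs_le_abs_sub (deriv ψ y) (g₂ y)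
    have h4 : 64 / y = 32 / y + 32 / y := by ring
    linarith

theorem eventually_isPhaseOn {φ ψ g g₂ : ℝ → ℝ} {κ : ℝ} (hκ : κ = 1 ∨ κ = -1)
    (hφ : ∀ᶠ y in atTop, IsNearlyLinearInverse φ g g₂ y)
    (hψ : ∀ᶠ y in atTop, 2 * y ^ (-(1 / 15) : ℝ) ≤ ψ y ∧ DifferentiableAt ℝ ψ y ∧
      |deriv ψ y| ≤ 64 / y) :
    ∀ᶠ s : ℝ in atTop, IsPhaseOn (-κ) 64 s (fun y => κ * φ y) (fun y => κ * g y) ψ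
      (Icc (s ^ 15) (2 * s ^ 15)) := by
  obtain ⟨Y, hY⟩ := eventually_atTop.1 (hφ.and hψ)
  filter_upwards [eventually_ge_atTop 1, eventually_ge_atTop Y] with s hs1 hsY
  have hs0 : 0 < s := by linarith
  have hN : 0 < s ^ 15 := by positivity
  have hmem : ∀ t ∈ Icc (s ^ 15) (2 * s ^ 15), Y ≤ t ∧ 0 < t := fun t ht =>
    ⟨hsY.trans ((le_self_pow₀ hs1 (by norm_num)).trans ht.1), hN.trans_le ht.1⟩
  have hκκ : κ * κ = 1 := by rcases hκ with rfl | rfl <;> norm_num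
  have hsign : ∀ a b : ℝ, -κ * (κ * a - κ * b) = -(a - b) := fun a b => by
    linear_combination (b - a) * hκκ
  have hpow : ∀ (a : ℝ), (s ^ 15) ^ (-(a / 15) : ℝ) = s ^ (-a) := by
    intro a
    rw [← Real.rpow_natCast, ← Real.rpow_mul hs0.le]
    congr 1
    push_cast
    ring
  have hslope : ∀ t ∈ Icc (s ^ 15) (2 * s ^ 15), ∀ t' ∈ Icc (s ^ 15) (2 * s ^ 15), t ≤ t' →
      (t' - t) / s ^ 16 ≤ -(g t' - g t) ∧ -(g t' - g t) ≤ 32 * (t' - t) / s ^ 15 := by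
    intro t ht t' ht' hle
    rcases hle.eq_or_lt with rfl | hlt
    · simp
    have hsub : Icc t t' ⊆ Icc (s ^ 15) (2 * s ^ 15) := Icc_subset_Icc ht.1 ht'.2
    have hd : ∀ x ∈ Icc t t', HasDerivAt g (g₂ x) x := fun x hx =>
      (hY x (hmem x (hsub hx)).1).1.deriv₂
    obtain ⟨x, hx, h1⟩ := exists_hasDerivAt_eq_slope g g₂ hlt
      (fun x hx => (hd x hx).continuousAt.continuousWithinAt)
      (fun x hx => hd x (Ioo_subset_Icc_self hx))
    have hxm := hsub (Ioo_subset_Icc_self hx)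
    obtain ⟨hxY, hx0⟩ := hmem x hxm
    have h2 := (hY x hxY).1
    have h3 : -(g t' - g t) = (t' - t) * (-g₂ x) := by
      rw [h1]
      have : t' - t ≠ 0 := by linarith
      field_simp
    rw [h3]
    have htt : 0 ≤ t' - t := by linarith
    constructor
    · rw [div_eq_mul_one_div]
      refine mul_le_mul_of_nonneg_left (le_trans ?_ h2.le_neg_deriv₂) htt
      have h5 : (2 * s ^ 15) ^ (-(16 / 15) : ℝ) ≤ x ^ (-(16 / 15) : ℝ) :=
        Real.rpow_le_rpow_of_nonpos hx0 hxm.2 (by norm_num)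
      -- The loss from `x ≤ 2 s ^ 15` is at most `4`, the constant in `le_neg_deriv₂`.
      have h6 : (1 / 4 : ℝ) ≤ 2 ^ (-(16 / 15) : ℝ) := by
        calc (1 / 4 : ℝ) = 2 ^ (-2 : ℝ) := by rw [Real.rpow_neg (by norm_num)]; norm_num
          _ ≤ _ := Real.rpow_le_rpow_of_exponent_le (by norm_num) (by norm_num)
      rw [Real.mul_rpow (by norm_num) hN.le, hpow 16, Real.rpow_neg hs0.le] at h5
      have h7 : s ^ (16 : ℝ) = s ^ 16 := by exact_mod_cast Real.rpow_natCast s 16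
      rw [h7] at h5
      have h8 : 1 / 4 * (s ^ 16)⁻¹ ≤ 2 ^ (-(16 / 15) : ℝ) * (s ^ 16)⁻¹ := by gcongr
      rw [one_div]
      linarith
    · rw [mul_comm 32, mul_div_assoc]
      refine mul_le_mul_of_nonneg_left (h2.neg_deriv₂_le.trans ?_) htt
      gcongr
      exact hxm.1
  refine ⟨?_, ?_, ?_, ?_, ?_⟩
  · intro t ht
    exact (hY t (hmem t ht).1).1.deriv.const_mul κ
  · intro t ht t' ht' hle
    rw [hsign]
    exact (hslope t ht t' ht' hle).1
  · intro t ht t' ht' hle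
    rw [hsign]
    refine (hslope t ht t' ht' hle).2.trans ?_
    have : 0 ≤ t' - t := by linarith
    gcongr
    norm_num
  · intro t ht
    obtain ⟨htY, ht0⟩ := hmem t ht
    refine le_trans ?_ (hY t htY).2.1
    have h5 : (2 * s ^ 15) ^ (-(1 / 15) : ℝ) ≤ t ^ (-(1 / 15) : ℝ) :=
      Real.rpow_le_rpow_of_nonpos ht0 ht.2 (by norm_num)
    have h6 : (1 / 2 : ℝ) ≤ 2 ^ (-(1 / 15) : ℝ) := by
      calc (1 / 2 : ℝ) = 2 ^ (-1 : ℝ) := by rw [Real.rpow_neg (by norm_num)]; norm_num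
        _ ≤ _ := Real.rpow_le_rpow_of_exponent_le (by norm_num) (by norm_num)
    rw [Real.mul_rpow (by norm_num) hN.le, hpow 1, Real.rpow_neg_one] at h5
    have h8 : 1 / 2 * s⁻¹ ≤ 2 ^ (-(1 / 15) : ℝ) * s⁻¹ := by gcongr
    rw [one_div]
    linarith
  · intro t ht t' ht'
    have := (convex_Icc (s ^ 15) (2 * s ^ 15)).norm_image_sub_le_of_norm_deriv_le (f := ψ)
      (C := 64 / s ^ 15) (fun x hx => (hY x (hmem x hx).1).2.2.1) (fun x hx => by
        rw [Real.norm_eq_abs]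
        refine (hY x (hmem x hx).1).2.2.2.trans ?_
        gcongr
        exact hx.1) ht' ht
    rw [Real.norm_eq_abs, Real.norm_eq_abs] at this
    exact this.trans_eq (by ring)

/-- The sets `B₊` (for `κ = 1`) and `B₋` (for `κ = -1`) are tame. -/
theorem isTameBohrSet {c₁ c₂ x₁ x₂ κ : ℝ} {h₁ h₂ ψ : ℝ → ℝ} {B : Set ℕ}
    (hc₁ : c₁ ∈ Ico (1 : ℝ) (16 / 15)) (hc₂ : c₂ ∈ Ico (1 : ℝ) (16 / 15))
    (hh₁ : IsRegularlyVarying c₁ x₁ h₁) (hh₂ : IsRegularlyVarying c₂ x₂ h₂)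
    (hψ : IsWidthFor (inverse x₂ h₂) ψ) (hκ : κ = 1 ∨ κ = -1)
    (hB : ∀ n : ℕ, n ∈ B ↔ h₁ x₁ ≤ n ∧ Int.fract (κ * inverse x₁ h₁ n) < ψ n) :
    -- The sign is `-κ` because `φ₁'` is decreasing.
    ∃ g, IsTameBohrSet B (-κ) 64 (fun y => κ * inverse x₁ h₁ y) g ψ := by
  obtain ⟨g, g₂, hg⟩ := hh₁.eventually_inverse hc₁.1 hc₁.2
  obtain ⟨γ, γ₂, hγ⟩ := hh₂.eventually_inverse hc₂.1 hc₂.2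
  refine ⟨fun y => κ * g y, ?_, by norm_num, ?_, ?_⟩
  · rcases hκ with rfl | rfl <;> norm_num
  · exact eventually_isPhaseOn hκ hg (hψ.eventually_bounds hγ)
  · filter_upwards [tendsto_natCast_atTop_atTop.eventually (eventually_ge_atTop (h₁ x₁))] with n hn
    rw [hB]
    exact and_iff_right hn

end ThinRoth

theorem theorem1p6 (c₁ c₂ : ℝ) (hc₁ : c₁ ∈ Set.Ico (1 : ℝ) (16 / 15))
    (hc₂ : c₂ ∈ Set.Ico (1 : ℝ) (16 / 15)) (x₁ x₂ : ℝ) (h₁ h₂ ψ : ℝ → ℝ)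
    (hh₁ : ThinRoth.IsRegularlyVarying c₁ x₁ h₁) (hh₂ : ThinRoth.IsRegularlyVarying c₂ x₂ h₂)
    (hψ : ThinRoth.IsWidthFor (ThinRoth.inverse x₂ h₂) ψ) :
    (∀ A : Set ℕ, A ⊆ ThinRoth.BPlus x₁ h₁ ψ →
      0 < ThinRoth.relUpperDensity A (ThinRoth.BPlus x₁ h₁ ψ) →
      (ThinRoth.nontrivialThreeAPs A).Infinite) ∧
    (∀ A : Set ℕ, A ⊆ ThinRoth.BMinus x₁ h₁ ψ →
      0 < ThinRoth.relUpperDensity A (ThinRoth.BMinus x₁ h₁ ψ) →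
      (ThinRoth.nontrivialThreeAPs A).Infinite) := by
  constructor
  · intro A hA hpos
    obtain ⟨g, hg⟩ := ThinRoth.isTameBohrSet (B := ThinRoth.BPlus x₁ h₁ ψ) hc₁ hc₂ hh₁ hh₂ hψ
      (Or.inl rfl) (fun n => by rw [one_mul]; rfl)
    exact hg.infinite_nontrivialThreeAPs hA hpos
  · intro A hA hpos
    obtain ⟨g, hg⟩ := ThinRoth.isTameBohrSet (B := ThinRoth.BMinus x₁ h₁ ψ) hc₁ hc₂ hh₁ hh₂ hψ
      (Or.inr rfl) (fun n => by rw [neg_one_mul]; rfl)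
    exact hg.infinite_nontrivialThreeAPs hA hpos
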